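/- **Theorem.** Let $m=(m_1,\dots,m_d)\in\mathbb N^d$ and let $\overrightarrow G_m$ be the equioriented commutative $d$-grid: its vertex set is $I=[1,m_1]\times\dots\times[1,m_d]$, there is exactly one arrow $i\to j$ when $j$ is obtained from $i$ by raising exactly one coordinate by $1$ and no other arrows (let $E$ be the set of arrows), and the relations $C$ say that any two parallel paths are equal. Let $\Bbbk$ be a field and $K\supseteq\Bbbk$ an infinite extension field (for instance $K=\Bbbk$ if $\Bbbk$ is infinite, or $K=\overline{\Bbbk}$ for any $\Bbbk$). Varieties over $\Bbbk$ are given by their $K$-points, with the Zariski topology whose closed sets are defined by polynomials with coefficients in $\Bbbk$. *Root system.* Let $A=(A_{ij})_{i,j\in I}$ be the symmetric matrix with $A_{ii}=2$ and $-A_{ij}$ the number of arrows between $i$ and $j$ (in both directions) for $i\ne j$. Let $(\mathfrak h,\{\alpha_i\}_{i\in I},\{h_i\}_{i\in I})$ be any realization of $A$: $\mathfrak h$ is a complex vector space of dimension $2|I|-\operatorname{rank}A$, the $\alpha_i\in\mathfrak h^*$ are linearly independent, the $h_i\in\mathfrak h$ are linearly independent, and $\langle h_i,\alpha_j\rangle=A_{ij}$.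 Let $P\subset\mathfrak h^*$ be any weight lattice: a free abelian subgroup such that the natural map $\mathbb C\otimes_{\mathbb Z}P\to\mathfrak h^*$ is an isomorphism, $\langle h_i,P\rangle\subset\mathbb Z$ and $\alpha_i\in P$ for all $i\in I$. *The set $B_C$.* A dimension vector $(\nu_i)\in\mathbb N^I$ is identified with $\nu=-\sum_i\nu_i\alpha_i\in P$. Let $E_C(\nu)$ be the closed subvariety of $\prod_{\tau\in E}\operatorname{Hom}(K^{\nu_{s(\tau)}},K^{\nu_{t(\tau)}})$ of all $f=(f_\tau)$ that satisfy the relations $C$ ($s(\tau),t(\tau)$ being the source and target of $\tau$), let $B_C(\nu)$ be the set of its irreducible components, and let $B_C=\bigsqcup_\nu B_C(\nu)$. *The maps $\mathrm{wt},\varepsilon_i,\varphi_i$.* For $f\in E_C(\nu)$ let $\varepsilon_i(f)$ be the dimension of the cokernel of $(f_\tau)_{t(\tau)=i}:\bigoplus_{t(\tau)=i}K^{\nu_{s(\tau)}}\to K^{\nu_i}$. For $\Lambda\in B_C(\nu)$ put $\mathrm{wt}(\Lambda)=\nu$, $\varepsilon_i(\Lambda)=\min_{f\in\Lambda}\varepsilon_i(f)$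 and $\varphi_i(\Lambda)=\varepsilon_i(\Lambda)+\langle h_i,\mathrm{wt}(\Lambda)\rangle$. *The extension variety.* Let $E'_C(\bar\nu,\nu')$ be the set of all $((\bar\phi_j)_{j\in I},(\phi'_j)_{j\in I},f)$ with $f\in E_C(\bar\nu+\nu')$, with $0\to K^{\bar\nu_j}\xrightarrow{\bar\phi_j}K^{\bar\nu_j+\nu'_j}\xrightarrow{\phi'_j}K^{\nu'_j}\to0$ exact for every $j\in I$, and with $f_\tau(\operatorname{im}\bar\phi_{s(\tau)})\subset\operatorname{im}\bar\phi_{t(\tau)}$ for every $\tau\in E$. Let $\varpi_1:E'_C(\bar\nu,\nu')\to E_C(\bar\nu)$ send such a triple to the induced subrepresentation $\bar f$ (so $\bar\phi_{t(\tau)}\bar f_\tau=f_\tau\bar\phi_{s(\tau)}$), and let $\varpi_2:E'_C(\bar\nu,\nu')\to E_C(\bar\nu+\nu')$ send it to $f$. Below these are used with $\nu'=-\alpha_i$. *The Kashiwara operators.* For $i\in I$ let $\mathrm{out}_1(i)$ be the set of targets of arrows from $i$, and $\mathrm{out}_2(i)$ the set of vertices $k$ with arrows $j_1\to k$, $j_2\to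 k$ for two different $j_1,j_2\in\mathrm{out}_1(i)$; the pair $\{j_1,j_2\}$ is then unique, and one writes $k=k(j_1,j_2)$ with $j_1<_{\rm lex}j_2$. For $f\in E_C(\nu)$ let $\widetilde{\mathrm{Ext}}_i(f)$ be the kernel of the linear map $\bigoplus_{j\in\mathrm{out}_1(i)}K^{\nu_j}\to\bigoplus_{k\in\mathrm{out}_2(i)}K^{\nu_k}$ whose component at $k=k(j_1,j_2)$ is $(v_j)_j\mapsto f_{(j_1,k)}v_{j_1}-f_{(j_2,k)}v_{j_2}$. - For $\bar\Lambda\in B_C(\nu)$ let $\bar\Lambda^1\subset\bar\Lambda$ be the locus where $\dim\widetilde{\mathrm{Ext}}_i$ takes its minimal value on $\bar\Lambda$. Using $E_C(\nu)\xleftarrow{\varpi_1}E'_C(\nu,-\alpha_i)\xrightarrow{\varpi_2}E_C(\nu-\alpha_i)$, put $\tilde f_i\bar\Lambda=\overline{\varpi_2\varpi_1^{-1}(\bar\Lambda^1)}$ if this is an element of $B_C(\nu-\alpha_i)$, and $\tilde f_i\bar\Lambda=0$ otherwise. - For $\Lambda\in B_C(\nu)$ let $\Lambda^2\subset\Lambda$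 be the locus where $\varepsilon_i$ takes its minimal value on $\Lambda$. If $\varepsilon_i(\Lambda)>0$ (so $\nu_i>0$), then, using $E_C(\nu+\alpha_i)\xleftarrow{\varpi_1}E'_C(\nu+\alpha_i,-\alpha_i)\xrightarrow{\varpi_2}E_C(\nu)$, put $\tilde e_i\Lambda=\overline{\varpi_1\varpi_2^{-1}(\Lambda^2)}$ if this is an element of $B_C(\nu+\alpha_i)$. In all other cases put $\tilde e_i\Lambda=0$. *Conclusion.* $A$ is a generalized Cartan matrix, and $(B_C,\mathrm{wt},(\varepsilon_i)_{i\in I},(\varphi_i)_{i\in I},(\tilde e_i)_{i\in I},(\tilde f_i)_{i\in I})$ is a Kashiwara crystal associated with $A$ and $P$, that is, for all $i\in I$ and $b,b'\in B_C$: 1. $\varphi_i(b)=\varepsilon_i(b)+\langle h_i,\mathrm{wt}(b)\rangle$; 2. if $\tilde e_ib\ne0$, then $\mathrm{wt}(\tilde e_ib)=\mathrm{wt}(b)+\alpha_i$, $\varepsilon_i(\tilde e_ib)=\varepsilon_i(b)-1$ and $\varphi_i(\tilde e_ib)=\varphi_i(b)+1$; 3. if $\tilde f_ib\ne0$, then $\mathrm{wt}(\tilde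 f_ib)=\mathrm{wt}(b)-\alpha_i$, $\varepsilon_i(\tilde f_ib)=\varepsilon_i(b)+1$ and $\varphi_i(\tilde f_ib)=\varphi_i(b)-1$; 4. $b=\tilde e_ib'$ if and only if $\tilde f_ib=b'$; 5. if $\varphi_i(b)=-\infty$, then $\tilde e_ib=\tilde f_ib=0$. -/

import Mathlib

noncomputable section

namespace GridCrystal

/-! ### Generalized Cartan matrices, realizations, weight lattices, crystals -/

/-- Generalized Cartan matrices. -/
structure IsGeneralizedCartanMatrix {I : Type*} (A : Matrix I I ℤ) : Prop where
  diag : ∀ i, A i i = 2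
  nonpos : ∀ i j, i ≠ j → A i j ≤ 0
  zero_symm : ∀ i j, i ≠ j → A i j ≠ 0 → A j i ≠ 0

/-- A realization `(𝔥, Π, Π^∨)` of a square integral matrix `A`, on a complex vector space `𝔥`. -/
structure Realization {I : Type*} [Fintype I] (A : Matrix I I ℤ)
    (𝔥 : Type*) [AddCommGroup 𝔥] [Module ℂ 𝔥] where
  /-- the simple roots `α_i` -/
  root : I → Module.Dual ℂ 𝔥
  /-- the simple coroots `h_i` -/
  coroot : I → 𝔥
  linearIndependent_root : LinearIndependent ℂ root
  linearIndependent_coroot : LinearIndependent ℂ coroot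
  pairing_eq : ∀ i j, root j (coroot i) = (A i j : ℂ)
  finiteDimensional : FiniteDimensional ℂ 𝔥
  finrank_add_rank : Module.finrank ℂ 𝔥 + (A.map (Int.cast : ℤ → ℂ)).rank = 2 * Fintype.card I

/-- A weight lattice `P ⊆ 𝔥^*` of a realization. -/
structure WeightLattice {I : Type*} [Fintype I] {A : Matrix I I ℤ}
    {𝔥 : Type*} [AddCommGroup 𝔥] [Module ℂ 𝔥] (R : Realization A 𝔥) where
  carrier : AddSubgroup (Module.Dual ℂ 𝔥)
  free : Module.Free ℤ carrier
  /-- the natural map `ℂ ⊗_ℤ P → 𝔥^*` is an isomorphism -/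
  isBaseChange : IsBaseChange ℂ carrier.subtype.toIntLinearMap
  integral : ∀ i, ∀ μ ∈ carrier, ∃ n : ℤ, μ (R.coroot i) = (n : ℂ)
  root_mem : ∀ i, R.root i ∈ carrier

namespace WeightLattice

variable {I : Type*} [Fintype I] {A : Matrix I I ℤ} {𝔥 : Type*} [AddCommGroup 𝔥] [Module ℂ 𝔥]
  {R : Realization A 𝔥} (P : WeightLattice R)

/-- The simple root `α_i` as an element of the weight lattice. -/
def simpleRoot (i : I) : P.carrier := ⟨R.root i, P.root_mem i⟩

/-- The integer `⟨h_i, μ⟩`. -/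
def pairing (i : I) (μ : P.carrier) : ℤ := (P.integral i μ.1 μ.2).choose

theorem pairing_spec (i : I) (μ : P.carrier) : μ.1 (R.coroot i) = (P.pairing i μ : ℂ) :=
  (P.integral i μ.1 μ.2).choose_spec

end WeightLattice

/-- `(B, wt, ε, φ, e, f)` is a Kashiwara crystal associated with the generalized Cartan matrix `A`
and the weight lattice `P`. The set `B ⊔ {0}` is `Option B`, with `0 = none`, and `ℤ ⊔ {-∞}` is
`WithBot ℤ`. -/
structure IsCrystal {I : Type*} [Fintype I] {A : Matrix I I ℤ}
    {𝔥 : Type*} [AddCommGroup 𝔥] [Module ℂ 𝔥] {R : Realization A 𝔥} (P : WeightLattice R)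
    {B : Type*} (wt : B → P.carrier) (ε φ : I → B → WithBot ℤ) (e f : I → B → Option B) :
    Prop where
  cartan : IsGeneralizedCartanMatrix A
  phi_eq : ∀ i b, φ i b = ε i b + ((P.pairing i (wt b) : ℤ) : WithBot ℤ)
  wt_e : ∀ i b b₁, e i b = some b₁ → wt b₁ = wt b + P.simpleRoot i
  eps_e : ∀ i b b₁, e i b = some b₁ → ε i b₁ = ε i b + ((-1 : ℤ) : WithBot ℤ)
  phi_e : ∀ i b b₁, e i b = some b₁ → φ i b₁ = φ i b + ((1 : ℤ) : WithBot ℤ)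
  wt_f : ∀ i b b₁, f i b = some b₁ → wt b₁ = wt b - P.simpleRoot i
  eps_f : ∀ i b b₁, f i b = some b₁ → ε i b₁ = ε i b + ((1 : ℤ) : WithBot ℤ)
  phi_f : ∀ i b b₁, f i b = some b₁ → φ i b₁ = φ i b + ((-1 : ℤ) : WithBot ℤ)
  e_eq_iff : ∀ i b b₁, e i b₁ = some b ↔ f i b = some b₁
  of_phi_eq_bot : ∀ i b, φ i b = ⊥ → e i b = none ∧ f i b = none

/-- The symmetric matrix attached to a quiver: `2` on the diagonal, and minus the number of arrows
between `i` and `j` (in both directions) off the diagonal. -/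
def quiverCartanMatrix (V : Type*) [Quiver V] [DecidableEq V] : Matrix V V ℤ := fun i j =>
  if i = j then 2 else -(Nat.card (i ⟶ j) : ℤ) - (Nat.card (j ⟶ i) : ℤ)

/-! ### The equioriented grid -/

/-- Vertices of the `d`-grid of size `m = (m_1, …, m_d)`: the product of the intervals
`[1, m_l]`, each written as `Fin (m l) = {0, …, m_l - 1}`. -/
def GridVertex {d : ℕ} (m : Fin d → ℕ) : Type := (l : Fin d) → Fin (m l)

variable {d : ℕ} {m : Fin d → ℕ}

instance : DecidableEq (GridVertex m) := inferInstanceAs (DecidableEq ((l : Fin d) → Fin (m l)))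

instance : Fintype (GridVertex m) := inferInstanceAs (Fintype ((l : Fin d) → Fin (m l)))

/-- There is an arrow `i ⟶ j` when `j` is `i` with exactly one coordinate raised by one. -/
def GridArrow (i j : GridVertex m) : Prop :=
  ∃ l : Fin d, (i l : ℕ) + 1 = (j l : ℕ) ∧ ∀ l₁ : Fin d, l₁ ≠ l → i l₁ = j l₁

/-- The underlying quiver of the grid; between two vertices there is at most one arrow. -/
instance : Quiver (GridVertex m) := ⟨fun i j => PLift (GridArrow i j)⟩

instance (i j : GridVertex m) : Finite (i ⟶ j) := inferInstanceAs (Finite (PLift (GridArrow i j)))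

instance (i j : GridVertex m) : Fintype (i ⟶ j) := Fintype.ofFinite _

/-- Strict lexicographical order on the vertices. -/
def GridLexLT (i j : GridVertex m) : Prop :=
  ∃ l : Fin d, i l < j l ∧ ∀ l₁ : Fin d, l₁ < l → i l₁ = j l₁

/-! ### Zariski topology -/

/-- The Zariski topology on the `K`-points of the affine space over `k` with coordinates indexed by
`σ`: the closed sets are the common zero loci in `σ → K` of sets (ideals) of polynomials with
coefficients in `k`. -/
@[reducible]
def zariskiTopology (k K σ : Type*) [Field k] [Field K] [Algebra k K] :
    TopologicalSpace (σ → K) :=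
  TopologicalSpace.ofClosed
    (Set.range fun J : Ideal (MvPolynomial σ k) => MvPolynomial.zeroLocus K J)
    ⟨⊤, MvPolynomial.zeroLocus_top⟩
    (by
      intro S hS
      refine ⟨sSup {J | MvPolynomial.zeroLocus K J ∈ S}, ?_⟩
      ext x
      constructor
      · intro hx Z hZ
        obtain ⟨J, rfl⟩ := hS hZ
        exact MvPolynomial.zeroLocus_anti_mono (le_sSup (by exact hZ)) hx
      · intro hx
        have hle : sSup {J : Ideal (MvPolynomial σ k) | MvPolynomial.zeroLocus K J ∈ S} ≤
            MvPolynomial.vanishingIdeal k {x} := by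
          refine sSup_le fun J hJ p hp y hy => ?_
          rw [Set.mem_singleton_iff] at hy
          subst hy
          exact hx _ hJ p hp
        exact fun p hp => hle hp x rfl)
    (by
      rintro _ ⟨J₁, rfl⟩ _ ⟨J₂, rfl⟩
      refine ⟨J₁ ⊓ J₂, Set.Subset.antisymm ?_ ?_⟩
      · intro x hx
        by_contra hcon
        simp only [Set.mem_union, MvPolynomial.mem_zeroLocus_iff, not_or, not_forall] at hcon
        obtain ⟨⟨p, hp, hpx⟩, q, hq, hqx⟩ := hcon
        have := hx (p * q) ⟨J₁.mul_mem_right _ hp, J₂.mul_mem_left _ hq⟩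
        rw [map_mul] at this
        exact (mul_ne_zero hpx hqx) this
      · rintro x (hx | hx) p hp
        · exact hx p hp.1
        · exact hx p hp.2)

/-! ### Representation varieties -/

section Rep

variable {K : Type*} [Field K] {ν : GridVertex m → ℕ}

/-- Representations of the grid quiver with `K^{ν_i}` at the vertex `i`; a linear map
`K^a → K^b` is given by its `b × a` matrix. -/
abbrev RepSpace (K : Type*) (ν : GridVertex m → ℕ) : Type _ :=
  ⦃i j : GridVertex m⦄ → (i ⟶ j) → Matrix (Fin (ν j)) (Fin (ν i)) K

/-- Evaluation of a representation on a path. -/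
def evalPath (f : RepSpace K ν) {i : GridVertex m} :
    {j : GridVertex m} → Quiver.Path i j → Matrix (Fin (ν j)) (Fin (ν i)) K
  | _, .nil => 1
  | _, .cons p a => f a * evalPath f p

/-- The commutative relations: any two parallel paths have the same evaluation. -/
def SatisfiesCommRel (f : RepSpace K ν) : Prop :=
  ∀ ⦃i j : GridVertex m⦄ (p q : Quiver.Path i j), evalPath f p = evalPath f q

/-- The representation variety `E_C(ν)` over the field `k`, through its `K`-points, for an
extension field `K` of `k`. The field `k` only enters through the topology. -/
def RepVariety (k K : Type*) [Field k] [Field K] [Algebra k K] (ν : GridVertex m → ℕ) : Type _ :=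
  {f : RepSpace K ν // SatisfiesCommRel f}

/-- Matrix entries of a representation, indexed by an arrow and a position in its matrix. -/
def repCoord (f : RepSpace K ν) :
    (Σ a : Quiver.Total (GridVertex m), Fin (ν a.right) × Fin (ν a.left)) → K :=
  fun x => f x.1.hom x.2.1 x.2.2

/-- The Zariski topology of `E_C(ν)`, as a closed subset of the affine space of all tuples of
matrices. -/
instance (k K : Type*) [Field k] [Field K] [Algebra k K] (ν : GridVertex m → ℕ) :
    TopologicalSpace (RepVariety k K ν) :=
  (zariskiTopology k K _).induced fun f => repCoord f.1

/-- The map `⊕_{τ, t(τ) = i} K^{ν_{s(τ)}} → K^{ν_i}`. -/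
def inMap (f : RepSpace K ν) (i : GridVertex m) :
    ((a : Quiver.Costar i) → (Fin (ν a.1) → K)) →ₗ[K] (Fin (ν i) → K) :=
  ∑ a : Quiver.Costar i, (f a.2).mulVecLin ∘ₗ LinearMap.proj a

/-- `ε_i(f)`, the dimension of the cokernel of the map into the vertex `i`. -/
def epsPoint (f : RepSpace K ν) (i : GridVertex m) : ℕ :=
  Module.finrank K ((Fin (ν i) → K) ⧸ LinearMap.range (inMap f i))

/-- `out_2(i)`, the vertices reached in two steps from `i` through two different vertices. -/
def OutTwo (i : GridVertex m) : Type :=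
  {v : GridVertex m // ∃ j₁ j₂ : GridVertex m, GridArrow i j₁ ∧ GridArrow i j₂ ∧ j₁ ≠ j₂ ∧
    GridArrow j₁ v ∧ GridArrow j₂ v}

open Classical in
/-- The block `K^{ν_j} → K^{ν_v}` of `F_i(f)`, for `j ∈ out_1(i)` (given as an arrow from `i`) and
`v ∈ out_2(i)`. -/
def extBlock (f : RepSpace K ν) (i : GridVertex m) (j : Quiver.Star i) (v : OutTwo i) :
    Matrix (Fin (ν v.1)) (Fin (ν j.1)) K :=
  if h : GridArrow j.1 v.1 ∧
      ∃ j₁ : GridVertex m, GridArrow i j₁ ∧ GridLexLT j.1 j₁ ∧ GridArrow j₁ v.1 then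
    f (PLift.up h.1)
  else if h : GridArrow j.1 v.1 ∧
      ∃ j₁ : GridVertex m, GridArrow i j₁ ∧ GridLexLT j₁ j.1 ∧ GridArrow j₁ v.1 then
    -f (PLift.up h.1)
  else 0

/-- `F_i(f) : ⊕_{j ∈ out_1(i)} K^{ν_j} → ⊕_{v ∈ out_2(i)} K^{ν_v}`. -/
def extMap (f : RepSpace K ν) (i : GridVertex m) :
    ((j : Quiver.Star i) → (Fin (ν j.1) → K)) →ₗ[K] ((v : OutTwo i) → (Fin (ν v.1) → K)) :=
  LinearMap.pi fun v => ∑ j : Quiver.Star i, (extBlock f i j v).mulVecLin ∘ₗ LinearMap.proj j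

/-- The dimension of `ker F_i(f)`. -/
def extDim (f : RepSpace K ν) (i : GridVertex m) : ℕ :=
  Module.finrank K (LinearMap.ker (extMap f i))

end Rep

/-! ### The variety of extensions -/

/-- The points of `E'_C(ν₁, ν₂)`, with the dimension vector `ν` of the middle term as a further
parameter: exactness forces `ν = ν₁ + ν₂`, and there is no point otherwise. -/
structure ExtVariety (k K : Type*) [Field k] [Field K] [Algebra k K]
    (ν₁ ν ν₂ : GridVertex m → ℕ) where
  inc : (i : GridVertex m) → Matrix (Fin (ν i)) (Fin (ν₁ i)) K
  quo : (i : GridVertex m) → Matrix (Fin (ν₂ i)) (Fin (ν i)) K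
  rep : RepSpace K ν
  inc_injective : ∀ i, Function.Injective (inc i).mulVecLin
  exact : ∀ i, LinearMap.range (inc i).mulVecLin = LinearMap.ker (quo i).mulVecLin
  quo_surjective : ∀ i, Function.Surjective (quo i).mulVecLin
  comm : SatisfiesCommRel rep
  stable : ∀ ⦃i j : GridVertex m⦄ (a : i ⟶ j),
    LinearMap.range ((rep a).mulVecLin ∘ₗ (inc i).mulVecLin) ≤ LinearMap.range (inc j).mulVecLin

namespace ExtVariety

variable {k K : Type*} [Field k] [Field K] [Algebra k K] {ν₁ ν ν₂ : GridVertex m → ℕ}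

theorem exists_sub (x : ExtVariety k K ν₁ ν ν₂) {i j : GridVertex m} (a : i ⟶ j) :
    ∃ g : Matrix (Fin (ν₁ j)) (Fin (ν₁ i)) K, x.inc j * g = x.rep a * x.inc i := by
  have h : ∀ c : Fin (ν₁ i), ∃ y : Fin (ν₁ j) → K,
      (x.inc j).mulVec y = (x.rep a * x.inc i).mulVec (Pi.single c 1) := by
    intro c
    obtain ⟨y, hy⟩ := x.stable a (LinearMap.mem_range_self _ (Pi.single c 1))
    refine ⟨y, ?_⟩
    rw [← Matrix.mulVec_mulVec]
    exact hy
  choose y hy using h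
  refine ⟨Matrix.of fun r c => y c r, ?_⟩
  ext r c
  have := congrFun (hy c) r
  rw [Matrix.mulVec_single_one] at this
  simpa [Matrix.mul_apply, Matrix.mulVec, dotProduct] using this

theorem inc_mul_cancel (x : ExtVariety k K ν₁ ν ν₂) {j : GridVertex m} {n : ℕ}
    {g₁ g₂ : Matrix (Fin (ν₁ j)) (Fin n) K} (h : x.inc j * g₁ = x.inc j * g₂) : g₁ = g₂ := by
  ext r c
  have : (x.inc j).mulVecLin (g₁.col c) = (x.inc j).mulVecLin (g₂.col c) := by
    ext s
    have := congrFun (congrFun h s) c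
    simpa [Matrix.mul_apply, Matrix.mulVec, dotProduct] using this
  exact congrFun (x.inc_injective j this) r

/-- The subrepresentation induced on `K^{ν₁}`. -/
def subRep (x : ExtVariety k K ν₁ ν ν₂) : RepSpace K ν₁ := fun _ _ a => (x.exists_sub a).choose

theorem subRep_spec (x : ExtVariety k K ν₁ ν ν₂) {i j : GridVertex m} (a : i ⟶ j) :
    x.inc j * x.subRep a = x.rep a * x.inc i :=
  (x.exists_sub a).choose_spec

theorem inc_mul_evalPath (x : ExtVariety k K ν₁ ν ν₂) {i j : GridVertex m}
    (p : Quiver.Path i j) : x.inc j * evalPath x.subRep p = evalPath x.rep p * x.inc i := by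
  induction p with
  | nil => simp [evalPath]
  | cons p a ih =>
    simp only [evalPath]
    rw [← Matrix.mul_assoc, subRep_spec, Matrix.mul_assoc, ih, Matrix.mul_assoc]

/-- `ϖ₁`, sending an extension to its subrepresentation. -/
def toSub (x : ExtVariety k K ν₁ ν ν₂) : RepVariety k K ν₁ :=
  ⟨x.subRep, fun _ _ p q => x.inc_mul_cancel (by
    rw [inc_mul_evalPath, inc_mul_evalPath, x.comm p q])⟩

/-- `ϖ₂`, sending an extension to its middle term. -/
def toMid (x : ExtVariety k K ν₁ ν ν₂) : RepVariety k K ν := ⟨x.rep, x.comm⟩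

end ExtVariety

/-! ### The set of irreducible components and the crystal data on it -/

/-- `B_C`, the disjoint union over all dimension vectors `ν` of the sets of irreducible components
of `E_C(ν)`. -/
def IrrComp (k K : Type*) [Field k] [Field K] [Algebra k K] {d : ℕ} (m : Fin d → ℕ) : Type _ :=
  Σ ν : GridVertex m → ℕ, {Λ : Set (RepVariety k K ν) // Λ ∈ irreducibleComponents _}

section Data

variable {k K : Type*} [Field k] [Field K] [Algebra k K]

/-- `ε_i` of a set of representations: the minimal value of `ε_i` on it. -/
def epsMin {ν : GridVertex m → ℕ} (Λ : Set (RepVariety k K ν)) (i : GridVertex m) : ℕ :=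
  sInf ((fun f => epsPoint f.1 i) '' Λ)

/-- The locus of `Λ` where `dim ker F_i` is minimal. -/
def extMinLocus {ν : GridVertex m → ℕ} (Λ : Set (RepVariety k K ν)) (i : GridVertex m) :
    Set (RepVariety k K ν) :=
  {f ∈ Λ | ∀ g ∈ Λ, extDim f.1 i ≤ extDim g.1 i}

/-- The locus of `Λ` where `ε_i` is minimal. -/
def epsMinLocus {ν : GridVertex m → ℕ} (Λ : Set (RepVariety k K ν)) (i : GridVertex m) :
    Set (RepVariety k K ν) :=
  {f ∈ Λ | ∀ g ∈ Λ, epsPoint f.1 i ≤ epsPoint g.1 i}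

/-- The closure of `ϖ₂ (ϖ₁⁻¹ (Λ¹))` in `E_C(ν - α_i)`; the dimension vector grows at `i`. -/
def fClosure {ν : GridVertex m → ℕ} (Λ : Set (RepVariety k K ν)) (i : GridVertex m) :
    Set (RepVariety k K (ν + Pi.single i 1)) :=
  closure (ExtVariety.toMid ''
    ((ExtVariety.toSub : ExtVariety k K ν (ν + Pi.single i 1) (Pi.single i 1) → _) ⁻¹'
      extMinLocus Λ i))

/-- The closure of `ϖ₁ (ϖ₂⁻¹ (Λ²))` in `E_C(ν + α_i)`; the dimension vector shrinks at `i`. It is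
only used when `ε_i(Λ) > 0`, and then `ν_i > 0`. -/
def eClosure {ν : GridVertex m → ℕ} (Λ : Set (RepVariety k K ν)) (i : GridVertex m) :
    Set (RepVariety k K (ν - Pi.single i 1)) :=
  closure (ExtVariety.toSub ''
    ((ExtVariety.toMid : ExtVariety k K (ν - Pi.single i 1) ν (Pi.single i 1) → _) ⁻¹'
      epsMinLocus Λ i))

open Classical in
/-- The Kashiwara operator `f̃_i`. -/
def fOp (i : GridVertex m) (b : IrrComp k K m) : Option (IrrComp k K m) :=
  if h : fClosure b.2.1 i ∈ irreducibleComponents _ then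
    some ⟨b.1 + Pi.single i 1, fClosure b.2.1 i, h⟩
  else none

open Classical in
/-- The Kashiwara operator `ẽ_i`. -/
def eOp (i : GridVertex m) (b : IrrComp k K m) : Option (IrrComp k K m) :=
  if h : 0 < epsMin b.2.1 i ∧ eClosure b.2.1 i ∈ irreducibleComponents _ then
    some ⟨b.1 - Pi.single i 1, eClosure b.2.1 i, h.2⟩
  else none

/-- `ε_i : B_C → ℤ ⊔ {-∞}`. -/
def eps (i : GridVertex m) (b : IrrComp k K m) : WithBot ℤ := ((epsMin b.2.1 i : ℤ) : WithBot ℤ)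

variable {𝔥 : Type*} [AddCommGroup 𝔥] [Module ℂ 𝔥]
  {R : Realization (quiverCartanMatrix (GridVertex m)) 𝔥} (P : WeightLattice R)

/-- `wt(Λ) = -∑ ν_i α_i` for a component `Λ` of `E_C(ν)`. -/
def wt (b : IrrComp k K m) : P.carrier := -∑ i, b.1 i • P.simpleRoot i

/-- `φ_i(Λ) = ε_i(Λ) + ⟨h_i, wt(Λ)⟩`. -/
def phi (i : GridVertex m) (b : IrrComp k K m) : WithBot ℤ :=
  eps i b + ((P.pairing i (wt P b) : ℤ) : WithBot ℤ)

end Data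

end GridCrystal

end

/-! An extension of the simple representation at `i` by `f̄`, with `f̄` as subrepresentation, is
governed by linear data on both sides. In a basis adapted to the exact sequences, one new basis
vector is added at `i`. Its images under the arrows out of `i` form a tuple in `⊕_{j ∈ out_1(i)}
K^{ν_j}`, and the only new relations are the squares starting at `i`: the tuple must lie in the
kernel of `extMap`. So the fibre of `ϖ₁` over `f̄` is parametrized by this kernel and a change of
basis. Conversely, a subrepresentation of `f` with that quotient is a hyperplane at `i` containing
the image of all incoming arrows, that is, a nonzero linear form on a cokernel of dimension
`ε_i(f)`. A family of vector spaces of constant dimension over an irreducible base is irreducible,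
and so is the part where the determinants of the base change do not vanish. Hence the preimages of
the loci `Λ¹` and `Λ²` are irreducible (`isPreirreducible_toSub_preimage`,
`isPreirreducible_toMid_preimage`), and so are the closures of their images.

Every such extension raises `ε_i` by exactly one (`epsPoint_toMid`), since each arrow into `i`
starts at a vertex where the subrepresentation is everything. As `ε_i` and `extDim` are upper
semicontinuous, a general point of an irreducible set minimizes both.

The equivalence of `b = ẽ_i b'` with `f̃_i b = b'` then follows from maximality of components. Going
up from `Λ` and down again gives an irreducible closed set containing a dense open part of `Λ`,
hence `Λ` itself (`closure_eImage_closure_fImage`). Going down and up again works in the same way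
(`closure_fImage_closure_eImage`): in the irreducible preimage of `Λ²`, the extensions whose
subrepresentation minimizes `extDim` form a nonempty open, hence dense, part. The remaining axioms
come from the dimension vector, from `epsPoint_toMid` and from `A i i = 2`.

Closed sets are defined over `k` while points have coordinates in `K`, so irreducibility of products
is not automatic. It is derived from algebras of `K`-valued functions: two functions that are not
identically zero must have a common point where neither vanishes. On affine fibres this uses that
`K` is infinite. -/

noncomputable section

namespace GridCrystal

/-! ### Algebras of functions and the topologies they define -/

section FunctionAlgebra

variable {k K : Type*} [Field k] [Field K] [Algebra k K]

/-- Matrix-valued functions all of whose entries belong to an algebra of functions. -/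
def RegMat {Z m n : Type*} (ℬ : Subalgebra k (Z → K)) (M : Z → Matrix m n K) : Prop :=
  ∀ i j, (fun z => M z i j) ∈ ℬ

namespace RegMat

variable {Z l m n : Type*} {ℬ : Subalgebra k (Z → K)}

theorem mul [Fintype m] {M : Z → Matrix l m K} {N : Z → Matrix m n K} (hM : RegMat ℬ M)
    (hN : RegMat ℬ N) : RegMat ℬ fun z => M z * N z := by
  intro i j
  have h : (fun z => (M z * N z) i j) = ∑ t, (fun z => M z i t) * fun z => N z t j := by
    ext z
    simp [Matrix.mul_apply, Finset.sum_apply]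
  rw [h]
  exact sum_mem fun t _ => mul_mem (hM i t) (hN t j)

theorem add {M N : Z → Matrix m n K} (hM : RegMat ℬ M) (hN : RegMat ℬ N) :
    RegMat ℬ fun z => M z + N z :=
  fun i j => add_mem (hM i j) (hN i j)

theorem sub {M N : Z → Matrix m n K} (hM : RegMat ℬ M) (hN : RegMat ℬ N) :
    RegMat ℬ fun z => M z - N z :=
  fun i j => sub_mem (hM i j) (hN i j)

theorem smul {c : Z → K} (hc : c ∈ ℬ) {M : Z → Matrix m n K} (hM : RegMat ℬ M) :
    RegMat ℬ fun z => c z • M z :=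
  fun i j => mul_mem hc (hM i j)

theorem const (M : Matrix m n k) : RegMat ℬ fun _ : Z => M.map (algebraMap k K) :=
  fun i j => ℬ.algebraMap_mem (M i j)

theorem one [DecidableEq m] : RegMat ℬ fun _ : Z => (1 : Matrix m m K) := by
  have h := const (K := K) (ℬ := ℬ) (1 : Matrix m m k)
  simpa using h

theorem det [Fintype m] [DecidableEq m] {M : Z → Matrix m m K} (hM : RegMat ℬ M) :
    (fun z => (M z).det) ∈ ℬ := by
  have h : (fun z => (M z).det) =
      ∑ σ : Equiv.Perm m, Equiv.Perm.sign σ • ∏ i, fun z => M z (σ i) i := by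
    ext z
    simp [Matrix.det_apply, Finset.sum_apply, Finset.prod_apply]
  rw [h]
  refine sum_mem fun σ _ => ?_
  rcases Int.units_eq_one_or (Equiv.Perm.sign σ) with hσ | hσ <;> rw [hσ]
  · rw [one_smul]
    exact prod_mem fun i _ => hM _ _
  · rw [Units.neg_smul, one_smul]
    exact neg_mem (prod_mem fun i _ => hM _ _)

theorem adjugate [Fintype m] [DecidableEq m] {M : Z → Matrix m m K} (hM : RegMat ℬ M) :
    RegMat ℬ fun z => (M z).adjugate := by
  intro i j
  simp only [Matrix.adjugate_apply]
  refine det (M := fun z => (M z).updateRow j (Pi.single i 1)) fun a b => ?_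
  by_cases ha : a = j
  · subst ha
    simp only [Matrix.updateRow_self]
    by_cases hb : b = i
    · subst hb
      simp only [Pi.single_eq_same]
      exact ℬ.one_mem
    · simp only [Pi.single_eq_of_ne hb]
      exact ℬ.zero_mem
  · simp only [Matrix.updateRow_ne ha]
    exact hM a b

end RegMat

/-- The topology whose closed sets are the zero loci of families of functions in `ℬ`. -/
@[reducible]
def funTop {Z : Type*} (ℬ : Subalgebra k (Z → K)) : TopologicalSpace Z :=
  TopologicalSpace.generateFrom {U | ∃ b ∈ ℬ, U = {z | b z ≠ 0}}

theorem isTopologicalBasis_funTop {Z : Type*} (ℬ : Subalgebra k (Z → K)) :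
    @TopologicalSpace.IsTopologicalBasis Z (funTop ℬ) {U | ∃ b ∈ ℬ, U = {z | b z ≠ 0}} := by
  let _ := funTop ℬ
  refine ⟨?_, ?_, rfl⟩
  · rintro _ ⟨a, ha, rfl⟩ _ ⟨b, hb, rfl⟩ x ⟨hxa, hxb⟩
    refine ⟨{z | (a * b) z ≠ 0}, ⟨a * b, mul_mem ha hb, rfl⟩, mul_ne_zero hxa hxb, ?_⟩
    exact fun y hy => ⟨left_ne_zero_of_mul hy, right_ne_zero_of_mul hy⟩
  · refine Set.eq_univ_of_forall fun x => Set.mem_sUnion.2 ⟨{z | (1 : Z → K) z ≠ 0},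
      ⟨1, one_mem ℬ, rfl⟩, one_ne_zero⟩

/-- Nonvanishing loci form a basis, so the hypothesis `h`, a form of "no zero divisors" tested on
points, says that nonempty open sets of `Z` meet. This passes to continuous images. -/
theorem isPreirreducible_range_of_funTop {Z Y : Type*} [TopologicalSpace Y]
    {ℬ : Subalgebra k (Z → K)}
    (h : ∀ a ∈ ℬ, ∀ b ∈ ℬ, (∃ z, a z ≠ 0) → (∃ z, b z ≠ 0) → ∃ z, a z ≠ 0 ∧ b z ≠ 0)
    {Φ : Z → Y} (hΦ : @Continuous _ _ (funTop ℬ) _ Φ) : IsPreirreducible (Set.range Φ) := by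
  let _ := funTop ℬ
  rintro U V hU hV ⟨_, ⟨z₁, rfl⟩, hz₁⟩ ⟨_, ⟨z₂, rfl⟩, hz₂⟩
  obtain ⟨_, ⟨a, ha, rfl⟩, ha₁, haU⟩ :=
    (isTopologicalBasis_funTop ℬ).exists_subset_of_mem_open hz₁ (hU.preimage hΦ)
  obtain ⟨_, ⟨b, hb, rfl⟩, hb₁, hbV⟩ :=
    (isTopologicalBasis_funTop ℬ).exists_subset_of_mem_open hz₂ (hV.preimage hΦ)
  obtain ⟨z, hza, hzb⟩ := h a ha b hb ⟨z₁, ha₁⟩ ⟨z₂, hb₁⟩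
  exact ⟨Φ z, ⟨z, rfl⟩, haU hza, hbV hzb⟩

/-- Functions on `X × K^τ` that are polynomial in the second variable, with coefficients in an
algebra of functions on `X`. -/
def polyFun {X : Type*} (𝒜 : Subalgebra k (X → K)) (τ : Type*) :
    Subalgebra k (X × (τ → K) → K) :=
  Algebra.adjoin k
    ({φ | ∃ a ∈ 𝒜, φ = fun z => a z.1} ∪ Set.range fun (t : τ) (z : X × (τ → K)) => z.2 t)

/-! ### Functions polynomial along the fibres of `X × K^τ → X`. -/

section PolyFun

variable {X τ : Type*} {𝒜 : Subalgebra k (X → K)}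

theorem fst_mem_polyFun {a : X → K} (ha : a ∈ 𝒜) :
    (fun z : X × (τ → K) => a z.1) ∈ polyFun 𝒜 τ :=
  Algebra.subset_adjoin (Or.inl ⟨a, ha, rfl⟩)

theorem coord_mem_polyFun (t : τ) : (fun z : X × (τ → K) => z.2 t) ∈ polyFun 𝒜 τ :=
  Algebra.subset_adjoin (Or.inr ⟨t, rfl⟩)

theorem polyFun_comp {Z : Type*} {ℬ : Subalgebra k (Z → K)} {π : Z → X}
    (hπ : ∀ a ∈ 𝒜, (fun z => a (π z)) ∈ ℬ) {u : Z → τ → K} (hu : ∀ t, (fun z => u z t) ∈ ℬ)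
    {q : X × (τ → K) → K} (hq : q ∈ polyFun 𝒜 τ) : (fun z => q (π z, u z)) ∈ ℬ := by
  induction hq using Algebra.adjoin_induction with
  | mem x hx =>
    rcases hx with ⟨a, ha, rfl⟩ | ⟨t, rfl⟩
    · exact hπ a ha
    · exact hu t
  | algebraMap r => exact ℬ.algebraMap_mem r
  | add x y _ _ hx hy => exact add_mem hx hy
  | mul x y _ _ hx hy => exact mul_mem hx hy

/-- Evaluation at a point, on an algebra of functions. -/
def evalAt (𝒜 : Subalgebra k (X → K)) (x : X) : 𝒜 →+* K :=
  (Pi.evalRingHom (fun _ => K) x).comp 𝒜.subtype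

theorem exists_mvPolynomial_of_mem_polyFun {q : X × (τ → K) → K} (hq : q ∈ polyFun 𝒜 τ) :
    ∃ p : MvPolynomial τ 𝒜, ∀ x w, q (x, w) = MvPolynomial.eval w (p.map (evalAt 𝒜 x)) := by
  induction hq using Algebra.adjoin_induction with
  | mem x hx =>
    rcases hx with ⟨a, ha, rfl⟩ | ⟨t, rfl⟩
    · exact ⟨MvPolynomial.C ⟨a, ha⟩, fun x w => by simp [evalAt]⟩
    · exact ⟨MvPolynomial.X t, fun x w => by simp⟩
  | algebraMap r => exact ⟨MvPolynomial.C (algebraMap k 𝒜 r), fun x w => by simp [evalAt]⟩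
  | add x y _ _ hx hy =>
    obtain ⟨p, hp⟩ := hx
    obtain ⟨q, hq⟩ := hy
    exact ⟨p + q, fun x w => by simp [hp, hq]⟩
  | mul x y _ _ hx hy =>
    obtain ⟨p, hp⟩ := hx
    obtain ⟨q, hq⟩ := hy
    exact ⟨p * q, fun x w => by simp [hp, hq]⟩

/-- Over an infinite field a polynomial vanishes as a function only if all its coefficients vanish,
so the set is the union of the nonvanishing loci of the coefficients. This is how existential
conditions with auxiliary parameters become open conditions on the base. -/
theorem isOpen_exists_ne_zero [Infinite K] [TopologicalSpace X]
    (hopen : ∀ a ∈ 𝒜, IsOpen {x | a x ≠ 0}) {q : X × (τ → K) → K} (hq : q ∈ polyFun 𝒜 τ) :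
    IsOpen {x | ∃ w, q (x, w) ≠ 0} := by
  obtain ⟨p, hp⟩ := exists_mvPolynomial_of_mem_polyFun hq
  have h : {x | ∃ w, q (x, w) ≠ 0} = ⋃ s, {x | (p.coeff s).1 x ≠ 0} := by
    ext x
    simp only [Set.mem_ofPred_eq, Set.mem_iUnion, hp]
    constructor
    · rintro ⟨w, hw⟩
      by_contra! hcon
      refine hw ?_
      have : p.map (evalAt 𝒜 x) = 0 := by
        ext s
        rw [MvPolynomial.coeff_map]
        exact hcon s
      rw [this, map_zero]
    · rintro ⟨s, hs⟩
      by_contra! hcon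
      have : p.map (evalAt 𝒜 x) = 0 := MvPolynomial.funext fun w => by rw [hcon w, map_zero]
      refine hs ?_
      have h2 := congrArg (MvPolynomial.coeff s) this
      rw [MvPolynomial.coeff_map] at h2
      exact h2
  rw [h]
  exact isOpen_iUnion fun s => hopen _ (p.coeff s).2

theorem exists_polynomial_on_line {q : X × (τ → K) → K} (hq : q ∈ polyFun 𝒜 τ) (x : X)
    (v w : τ → K) : ∃ p : Polynomial K, ∀ c : K, q (x, v + c • w) = p.eval c := by
  induction hq using Algebra.adjoin_induction with
  | mem y hy =>
    rcases hy with ⟨a, ha, rfl⟩ | ⟨t, rfl⟩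
    · exact ⟨Polynomial.C (a x), fun c => by simp⟩
    · exact ⟨Polynomial.C (v t) + Polynomial.C (w t) * Polynomial.X, fun c => by
        simp [mul_comm c]⟩
  | algebraMap r => exact ⟨Polynomial.C (algebraMap k K r), fun c => by simp⟩
  | add x y _ _ hx hy =>
    obtain ⟨p, hp⟩ := hx
    obtain ⟨q, hq⟩ := hy
    exact ⟨p + q, fun c => by simp [hp, hq]⟩
  | mul x y _ _ hx hy =>
    obtain ⟨p, hp⟩ := hx
    obtain ⟨q, hq⟩ := hy
    exact ⟨p * q, fun c => by simp [hp, hq]⟩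

/-- Irreducibility of a single fibre: on the line through `v₁` and `v₂`, which stays in `V`, both
functions are nonzero polynomials in one variable, and so is their product. -/
theorem exists_mem_ne_zero_of_submodule [Infinite K] {q₁ q₂ : X × (τ → K) → K}
    (h₁ : q₁ ∈ polyFun 𝒜 τ) (h₂ : q₂ ∈ polyFun 𝒜 τ) (x : X) (V : Submodule K (τ → K))
    {v₁ v₂ : τ → K} (hv₁ : v₁ ∈ V) (hv₂ : v₂ ∈ V) (hq₁ : q₁ (x, v₁) ≠ 0) (hq₂ : q₂ (x, v₂) ≠ 0) :
    ∃ v ∈ V, q₁ (x, v) ≠ 0 ∧ q₂ (x, v) ≠ 0 := by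
  obtain ⟨p₁, hp₁⟩ := exists_polynomial_on_line h₁ x v₁ (v₂ - v₁)
  obtain ⟨p₂, hp₂⟩ := exists_polynomial_on_line h₂ x v₁ (v₂ - v₁)
  have h0 : p₁ ≠ 0 := by
    rintro rfl
    have := hp₁ 0
    simp at this
    exact hq₁ this
  have h1 : p₂ ≠ 0 := by
    rintro rfl
    have := hp₂ 1
    simp at this
    exact hq₂ this
  obtain ⟨c, hc⟩ : ∃ c, (p₁ * p₂).eval c ≠ 0 := by
    by_contra! hcon
    exact mul_ne_zero h0 h1 (Polynomial.funext fun c => by rw [hcon c, Polynomial.eval_zero])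
  rw [Polynomial.eval_mul] at hc
  refine ⟨v₁ + c • (v₂ - v₁), V.add_mem hv₁ (V.smul_mem _ (V.sub_mem hv₂ hv₁)), ?_, ?_⟩
  · rw [hp₁]
    exact left_ne_zero_of_mul hc
  · rw [hp₂]
    exact right_ne_zero_of_mul hc

end PolyFun

/-! ### Families of linear maps of constant rank -/

section Rank

variable {ρ τ : Type*} [Fintype ρ] [Fintype τ]

/-- A substitute for minors in which `B` and `C` range over affine spaces, so that
`isOpen_exists_ne_zero` applies. For the forward direction, `C` picks preimages of `r` independent
vectors of the range and `B` is a left inverse of `A * C`. -/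
theorem le_rank_iff_exists_det_ne_zero [DecidableEq τ] (A : Matrix ρ τ K) (r : ℕ) :
    r ≤ A.rank ↔ ∃ (B : Matrix (Fin r) ρ K) (C : Matrix τ (Fin r) K), (B * A * C).det ≠ 0 := by
  classical
  constructor
  · intro h
    rw [Matrix.rank] at h
    obtain ⟨y, hy⟩ := exists_linearIndependent_of_le_finrank h
    choose c hc using fun j => (y j).2
    have hinj : Function.Injective (A * Matrix.of fun t j => c j t).mulVecLin := by
      rw [← LinearMap.ker_eq_bot, LinearMap.ker_eq_bot']
      intro s hs
      have hy2 := hy.map' (LinearMap.range A.mulVecLin).subtype (Submodule.ker_subtype _)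
      have hs2 : ∑ j, s j • (y j : ρ → K) = 0 := by
        rw [← hs, Matrix.mulVecLin_mul, LinearMap.comp_apply]
        simp only [← hc, ← map_smul, ← map_sum]
        congr 1
        ext t
        simp [Matrix.mulVec, dotProduct, Finset.sum_apply, mul_comm]
      ext j
      exact Fintype.linearIndependent_iff.1 hy2 s hs2 j
    obtain ⟨g, hg⟩ := LinearMap.exists_leftInverse_of_injective _ (LinearMap.ker_eq_bot.2 hinj)
    refine ⟨LinearMap.toMatrix' g, Matrix.of fun t j => c j t, ?_⟩
    have h1 : LinearMap.toMatrix' g * A * (Matrix.of fun t j => c j t) = 1 := by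
      have h2 := congrArg LinearMap.toMatrix' hg
      rw [LinearMap.toMatrix'_comp, LinearMap.toMatrix'_id] at h2
      rw [Matrix.mul_assoc, ← h2, ← Matrix.toLin'_apply', LinearMap.toMatrix'_toLin']
    rw [h1, Matrix.det_one]
    exact one_ne_zero
  · rintro ⟨B, C, h⟩
    have h1 : (B * A * C).rank = r := by
      rw [Matrix.rank_of_isUnit _ ((Matrix.isUnit_iff_isUnit_det _).2 h.isUnit), Fintype.card_fin]
    calc r = (B * A * C).rank := h1.symm
      _ ≤ (B * A).rank := Matrix.rank_mul_le_left _ _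
      _ ≤ A.rank := Matrix.rank_mul_le_right _ _

theorem rank_add_finrank_ker {ρ : Type*} [DecidableEq τ] (A : Matrix ρ τ K) :
    A.rank + Module.finrank K (LinearMap.ker A.mulVecLin) = Fintype.card τ := by
  rw [Matrix.rank, LinearMap.finrank_range_add_finrank_ker, Module.finrank_fintype_fun_eq_card]

/-- When `B A C` is invertible, this matrix maps into the kernel of `B A`, and is a multiple of the
identity there. -/
def kerProj [DecidableEq τ] {r : ℕ} (A : Matrix ρ τ K) (B : Matrix (Fin r) ρ K)
    (C : Matrix τ (Fin r) K) : Matrix τ τ K :=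
  (B * A * C).det • 1 - C * (B * A * C).adjugate * (B * A)

theorem mul_kerProj [DecidableEq τ] {r : ℕ} (A : Matrix ρ τ K) (B : Matrix (Fin r) ρ K)
    (C : Matrix τ (Fin r) K) : B * A * kerProj A B C = 0 := by
  rw [kerProj, Matrix.mul_sub, Matrix.mul_assoc C, ← Matrix.mul_assoc (B * A) C,
    ← Matrix.mul_assoc (B * A * C), Matrix.mul_adjugate]
  simp

theorem kerProj_mulVec [DecidableEq τ] {r : ℕ} (A : Matrix ρ τ K) (B : Matrix (Fin r) ρ K)
    (C : Matrix τ (Fin r) K) {v : τ → K} (hv : A.mulVec v = 0) :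
    (kerProj A B C).mulVec v = (B * A * C).det • v := by
  rw [kerProj, Matrix.sub_mulVec, ← Matrix.mulVec_mulVec v (C * _),
    ← Matrix.mulVec_mulVec v B, hv]
  simp [Matrix.smul_mulVec]

/-- `kerProj` only visibly lands in the kernel of `B * A`. When the rank of `A` is exactly `r`, that
kernel has the same dimension as the kernel of `A` and contains it, so the two agree. -/
theorem mulVec_kerProj_mulVec [DecidableEq τ] (A : Matrix ρ τ K) {r : ℕ} (hr : A.rank = r)
    (B : Matrix (Fin r) ρ K) (C : Matrix τ (Fin r) K) (h : (B * A * C).det ≠ 0) (w : τ → K) :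
    A.mulVec ((kerProj A B C).mulVec w) = 0 := by
  have h1 : r ≤ (B * A).rank := (le_rank_iff_exists_det_ne_zero _ _).2 ⟨1, C, by simpa using h⟩
  have h2 : LinearMap.ker A.mulVecLin = LinearMap.ker (B * A).mulVecLin := by
    refine Submodule.eq_of_le_of_finrank_le ?_ ?_
    · intro v hv
      rw [LinearMap.mem_ker, Matrix.mulVecLin_mul, LinearMap.comp_apply, LinearMap.mem_ker.1 hv,
        map_zero]
    · have := rank_add_finrank_ker A
      have := rank_add_finrank_ker (B * A)
      omega
  have h3 : (kerProj A B C).mulVec w ∈ LinearMap.ker (B * A).mulVecLin := by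
    rw [LinearMap.mem_ker, Matrix.mulVecLin_apply, Matrix.mulVec_mulVec, mul_kerProj,
      Matrix.zero_mulVec]
  rw [← h2] at h3
  exact h3

/-! ### Semicontinuity and irreducibility for families of kernels. -/

variable {X : Type*} {𝒜 : Subalgebra k (X → K)}

theorem isOpen_finrank_ker_le [Infinite K] [DecidableEq τ] [TopologicalSpace X]
    (hopen : ∀ a ∈ 𝒜, IsOpen {x | a x ≠ 0}) {A : X → Matrix ρ τ K} (hA : RegMat 𝒜 A) (c : ℕ) :
    IsOpen {x | Module.finrank K (LinearMap.ker (A x).mulVecLin) ≤ c} := by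
  -- If `c` exceeds the number of columns, the truncated difference is `0` and both conditions hold
  -- everywhere.
  set r := Fintype.card τ - c with hr
  let q : X × ((Fin r × ρ ⊕ τ × Fin r) → K) → K := fun z =>
    (Matrix.of (fun i j => z.2 (Sum.inl (i, j))) * A z.1 *
      Matrix.of fun i j => z.2 (Sum.inr (i, j))).det
  have hq : q ∈ polyFun 𝒜 (Fin r × ρ ⊕ τ × Fin r) :=
    RegMat.det (((show RegMat _ _ from fun i j => coord_mem_polyFun _).mul
      fun i j => fst_mem_polyFun (hA i j)).mul fun i j => coord_mem_polyFun _)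
  convert isOpen_exists_ne_zero hopen hq using 1
  ext x
  have h := rank_add_finrank_ker (A x)
  rw [Set.mem_ofPred_eq, Set.mem_ofPred_eq,
    show Module.finrank K (LinearMap.ker (A x).mulVecLin) ≤ c ↔ r ≤ (A x).rank by omega,
    le_rank_iff_exists_det_ne_zero]
  constructor
  · rintro ⟨B, C, h⟩
    exact ⟨Sum.elim (fun p => B p.1 p.2) fun p => C p.1 p.2, h⟩
  · rintro ⟨w, h⟩
    exact ⟨_, _, h⟩

/-- Functions on a subset `Z` that become restrictions of elements of `𝒬` after multiplication by a
power of `δ`. -/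
def locFun {Y : Type*} (𝒬 : Subalgebra k (Y → K)) {δ : Y → K} (hδ : δ ∈ 𝒬) (Z : Set Y) :
    Subalgebra k (Z → K) where
  carrier := {φ | ∃ N : ℕ, ∃ q ∈ 𝒬, ∀ z : Z, δ z ^ N * φ z = q z}
  mul_mem' := by
    rintro φ ψ ⟨N, p, hp, h⟩ ⟨M, q, hq, h'⟩
    refine ⟨N + M, p * q, mul_mem hp hq, fun z => ?_⟩
    rw [Pi.mul_apply, Pi.mul_apply, ← h, ← h']
    ring
  add_mem' := by
    rintro φ ψ ⟨N, p, hp, h⟩ ⟨M, q, hq, h'⟩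
    refine ⟨N + M, δ ^ M * p + δ ^ N * q,
      add_mem (mul_mem (pow_mem hδ _) hp) (mul_mem (pow_mem hδ _) hq), fun z => ?_⟩
    simp only [Pi.mul_apply, Pi.add_apply, Pi.pow_apply, ← h, ← h']
    ring
  algebraMap_mem' r := ⟨0, algebraMap k _ r, 𝒬.algebraMap_mem r, fun z => by simp⟩

theorem restrict_mem_locFun {Y : Type*} {𝒬 : Subalgebra k (Y → K)} {δ : Y → K} (hδ : δ ∈ 𝒬)
    {Z : Set Y} {q : Y → K} (hq : q ∈ 𝒬) : (fun z : Z => q z) ∈ locFun 𝒬 hδ Z :=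
  ⟨0, q, hq, fun z => by simp⟩

/-- The part of a family of kernels over `S` where `δ` does not vanish. -/
def kerBundle (S : Set X) (A : X → Matrix ρ τ K) (δ : X × (τ → K) → K) : Set (X × (τ → K)) :=
  {z | z.1 ∈ S ∧ (A z.1).mulVec z.2 = 0 ∧ δ z ≠ 0}

/-- The total space of a family of kernels of constant dimension over an irreducible base is
irreducible, also after removing the zeros of `δ`. Irreducibility of `S` yields a common base point,
and irreducibility of the fibre yields a common vector above it. -/
theorem kerBundle_exists_ne_zero [Infinite K] [TopologicalSpace X]
    (hopen : ∀ a ∈ 𝒜, IsOpen {x | a x ≠ 0}) {S : Set X} (hS : IsPreirreducible S)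
    {A : X → Matrix ρ τ K} (hA : RegMat 𝒜 A) {c : ℕ}
    (hc : ∀ x ∈ S, Module.finrank K (LinearMap.ker (A x).mulVecLin) = c)
    {δ : X × (τ → K) → K} (hδ : δ ∈ polyFun 𝒜 τ) :
    ∀ a ∈ locFun (polyFun 𝒜 τ) hδ (kerBundle S A δ),
      ∀ b ∈ locFun (polyFun 𝒜 τ) hδ (kerBundle S A δ),
        (∃ z, a z ≠ 0) → (∃ z, b z ≠ 0) → ∃ z, a z ≠ 0 ∧ b z ≠ 0 := by
  classical
  -- The points over which `q` is not identically zero on the kernel form a relatively open subset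
  -- of `S`: constant rank lets `kerProj` sweep out the kernel polynomially in the parameters `B`,
  -- `C` and a vector `w`.
  have key : ∀ q ∈ polyFun 𝒜 τ, ∃ U : Set X, IsOpen U ∧
      ∀ x ∈ S, x ∈ U ↔ ∃ v, (A x).mulVec v = 0 ∧ q (x, v) ≠ 0 := by
    intro q hq
    set r := Fintype.card τ - c with hr
    have hrank : ∀ x ∈ S, (A x).rank = r := by
      intro x hx
      have := rank_add_finrank_ker (A x)
      have := hc x hx
      omega
    let B : X × ((Fin r × ρ ⊕ τ × Fin r ⊕ τ) → K) → Matrix (Fin r) ρ K :=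
      fun z => Matrix.of fun i j => z.2 (Sum.inl (i, j))
    let C : X × ((Fin r × ρ ⊕ τ × Fin r ⊕ τ) → K) → Matrix τ (Fin r) K :=
      fun z => Matrix.of fun i j => z.2 (Sum.inr (Sum.inl (i, j)))
    have hB : RegMat (polyFun 𝒜 _) B := fun i j => coord_mem_polyFun _
    have hC : RegMat (polyFun 𝒜 _) C := fun i j => coord_mem_polyFun _
    have hA' : RegMat (polyFun 𝒜 _)
        fun z : X × ((Fin r × ρ ⊕ τ × Fin r ⊕ τ) → K) => A z.1 :=
      fun i j => fst_mem_polyFun (hA i j)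
    have hBA := hB.mul hA'
    have hBAC := hBA.mul hC
    have hP : RegMat (polyFun 𝒜 _) fun z => kerProj (A z.1) (B z) (C z) :=
      (RegMat.one.smul hBAC.det).sub ((hC.mul hBAC.adjugate).mul hBA)
    have hw : RegMat (polyFun 𝒜 _) fun z : X × ((Fin r × ρ ⊕ τ × Fin r ⊕ τ) → K) =>
        (Matrix.of fun t (_ : Unit) => z.2 (Sum.inr (Sum.inr t)) : Matrix τ Unit K) :=
      fun i j => coord_mem_polyFun _
    let u : X × ((Fin r × ρ ⊕ τ × Fin r ⊕ τ) → K) → τ → K := fun z =>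
      (kerProj (A z.1) (B z) (C z)).mulVec fun t => z.2 (Sum.inr (Sum.inr t))
    have hu : ∀ t, (fun z => u z t) ∈ polyFun 𝒜 _ := fun t => (hP.mul hw) t ()
    have hq' : (fun z => (B z * A z.1 * C z).det * q (z.1, u z)) ∈ polyFun 𝒜 _ :=
      mul_mem hBAC.det (polyFun_comp (fun a ha => fst_mem_polyFun ha) hu hq)
    refine ⟨_, isOpen_exists_ne_zero hopen hq', fun x hx => ⟨?_, ?_⟩⟩
    · rintro ⟨w, hw⟩
      exact ⟨u (x, w), mulVec_kerProj_mulVec _ (hrank x hx) _ _ (left_ne_zero_of_mul hw) _,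
        right_ne_zero_of_mul hw⟩
    · rintro ⟨v, hv, hqv⟩
      -- On the kernel `kerProj` is multiplication by the determinant, so dividing `v` by it gives a
      -- parameter that is sent to `v`.
      obtain ⟨B₀, C₀, h₀⟩ := (le_rank_iff_exists_det_ne_zero (A x) r).1 (hrank x hx).ge
      refine ⟨Sum.elim (fun p => B₀ p.1 p.2) (Sum.elim (fun p => C₀ p.1 p.2)
        ((B₀ * A x * C₀).det⁻¹ • v)), ?_⟩
      have hu0 : u (x, Sum.elim (fun p => B₀ p.1 p.2) (Sum.elim (fun p => C₀ p.1 p.2)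
          ((B₀ * A x * C₀).det⁻¹ • v))) = v := by
        change (kerProj (A x) B₀ C₀).mulVec ((B₀ * A x * C₀).det⁻¹ • v) = v
        rw [Matrix.mulVec_smul, kerProj_mulVec _ _ _ hv, smul_smul, inv_mul_cancel₀ h₀, one_smul]
      refine mul_ne_zero h₀ ?_
      rw [hu0]
      exact hqv
  rintro a ⟨N, p, hp, h⟩ b ⟨M, q, hq, h'⟩ ⟨z₁, hz₁⟩ ⟨z₂, hz₂⟩
  -- The extra factor `δ` forces the point found below into the bundle; without it, `N = 0` would
  -- give no control of `δ`.
  obtain ⟨U, hU, hUiff⟩ := key (δ * p) (mul_mem hδ hp)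
  obtain ⟨V, hV, hViff⟩ := key (δ * q) (mul_mem hδ hq)
  have hp₁ : (δ * p) z₁ ≠ 0 := by
    rw [Pi.mul_apply, ← h]
    exact mul_ne_zero z₁.2.2.2 (mul_ne_zero (pow_ne_zero _ z₁.2.2.2) hz₁)
  have hq₂ : (δ * q) z₂ ≠ 0 := by
    rw [Pi.mul_apply, ← h']
    exact mul_ne_zero z₂.2.2.2 (mul_ne_zero (pow_ne_zero _ z₂.2.2.2) hz₂)
  obtain ⟨x, hxS, hxU, hxV⟩ := hS U V hU hV
    ⟨z₁.1.1, z₁.2.1, (hUiff _ z₁.2.1).2 ⟨z₁.1.2, z₁.2.2.1, hp₁⟩⟩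
    ⟨z₂.1.1, z₂.2.1, (hViff _ z₂.2.1).2 ⟨z₂.1.2, z₂.2.2.1, hq₂⟩⟩
  obtain ⟨v₁, hv₁, hpv⟩ := (hUiff x hxS).1 hxU
  obtain ⟨v₂, hv₂, hqv⟩ := (hViff x hxS).1 hxV
  obtain ⟨v, hv, h1, h2⟩ := exists_mem_ne_zero_of_submodule (mul_mem hδ hp) (mul_mem hδ hq) x
    (LinearMap.ker (A x).mulVecLin) hv₁ hv₂ hpv hqv
  refine ⟨⟨(x, v), hxS, hv, left_ne_zero_of_mul h1⟩, fun h0 => ?_, fun h0 => ?_⟩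
  · refine right_ne_zero_of_mul h1 ?_
    have := h ⟨(x, v), hxS, hv, left_ne_zero_of_mul h1⟩
    rw [h0, mul_zero] at this
    exact this.symm
  · refine right_ne_zero_of_mul h2 ?_
    have := h' ⟨(x, v), hxS, hv, left_ne_zero_of_mul h1⟩
    rw [h0, mul_zero] at this
    exact this.symm

end Rank

end FunctionAlgebra

/-! ### Regular functions on representation varieties -/

section RepAlg

variable (k K : Type*) [Field k] [Field K] [Algebra k K] {d : ℕ} {m : Fin d → ℕ}
  (ν : GridVertex m → ℕ)

/-- The algebra of polynomial functions on `E_C(ν)`. -/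
def repAlg : Subalgebra k (RepVariety k K ν → K) :=
  (MvPolynomial.aeval fun s (f : RepVariety k K ν) => repCoord f.1 s).range

variable {k K ν}

theorem aeval_repCoord (p : MvPolynomial _ k) (f : RepVariety k K ν) :
    MvPolynomial.aeval (fun s (f : RepVariety k K ν) => repCoord f.1 s) p f =
      MvPolynomial.aeval (repCoord f.1) p := by
  induction p using MvPolynomial.induction_on with
  | C a => simp
  | add p q hp hq => simp [hp, hq]
  | mul_X p n hp => simp [hp]

theorem isClosed_zariskiTopology_iff {σ : Type*} {s : Set (σ → K)} :
    @IsClosed _ (zariskiTopology k K σ) s ↔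
      ∃ J : Ideal (MvPolynomial σ k), MvPolynomial.zeroLocus K J = s := by
  rw [← @isOpen_compl_iff _ _ (zariskiTopology k K σ)]
  change sᶜᶜ ∈ Set.range _ ↔ _
  rw [compl_compl, Set.mem_range]

theorem isOpen_repAlg {a : RepVariety k K ν → K} (ha : a ∈ repAlg k K ν) :
    IsOpen {f | a f ≠ 0} := by
  obtain ⟨p, rfl⟩ := ha
  rw [← isClosed_compl_iff]
  let _ := zariskiTopology k K (Σ a : Quiver.Total (GridVertex m), Fin (ν a.right) × Fin (ν a.left))
  refine isClosed_induced_iff.2 ⟨MvPolynomial.zeroLocus K (Ideal.span {p}),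
    isClosed_zariskiTopology_iff.2 ⟨_, rfl⟩, ?_⟩
  ext f
  simp [MvPolynomial.zeroLocus_span, aeval_repCoord]

theorem regMat_repAlg {i j : GridVertex m} (a : i ⟶ j) :
    RegMat (repAlg k K ν) fun f => f.1 a :=
  fun r c => ⟨MvPolynomial.X ⟨⟨i, j, a⟩, r, c⟩, by ext f; simp [repCoord]⟩

theorem continuous_funTop_of_regMat {Z : Type*} {ℬ : Subalgebra k (Z → K)}
    {Φ : Z → RepVariety k K ν}
    (h : ∀ ⦃i j : GridVertex m⦄ (a : i ⟶ j), RegMat ℬ fun z => (Φ z).1 a) :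
    @Continuous _ _ (funTop ℬ) _ Φ := by
  let _ := funTop ℬ
  have hmem : ∀ p : MvPolynomial _ k,
      (fun z => MvPolynomial.aeval (repCoord (Φ z).1) p) ∈ ℬ := by
    intro p
    induction p using MvPolynomial.induction_on with
    | C a =>
      simp only [MvPolynomial.aeval_C]
      exact ℬ.algebraMap_mem a
    | add p q hp hq =>
      simp only [map_add]
      exact add_mem hp hq
    | mul_X p n hp =>
      simp only [map_mul, MvPolynomial.aeval_X]
      exact mul_mem hp (h n.1.hom n.2.1 n.2.2)
  refine continuous_induced_rng.2 ?_
  let _ := zariskiTopology k K (Σ a : Quiver.Total (GridVertex m), Fin (ν a.right) × Fin (ν a.left))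
  refine continuous_iff_isClosed.2 fun s hs => ?_
  obtain ⟨J, rfl⟩ := isClosed_zariskiTopology_iff.1 hs
  have : ((fun f : RepVariety k K ν => repCoord f.1) ∘ Φ) ⁻¹' MvPolynomial.zeroLocus K J =
      ⋂ p ∈ J, {z | MvPolynomial.aeval (repCoord (Φ z).1) p ≠ 0}ᶜ := by
    ext z
    simp [MvPolynomial.mem_zeroLocus_iff]
  rw [this]
  exact isClosed_biInter fun p _ => isClosed_compl_iff.2
    (TopologicalSpace.isOpen_generateFrom_of_mem ⟨_, hmem p, rfl⟩)

end RepAlg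

/-! ### Commutative squares in the grid -/

section Squares

variable {d : ℕ} {m : Fin d → ℕ}

theorem gridArrow_iff {i j : GridVertex m} : GridArrow i j ↔
    ∃ l : Fin d, ∀ l₁ : Fin d, (j l₁ : ℕ) = i l₁ + if l₁ = l then 1 else 0 := by
  constructor
  · rintro ⟨l, h1, h2⟩
    refine ⟨l, fun l₁ => ?_⟩
    split_ifs with h
    · rw [h, h1]
    · rw [h2 l₁ h, add_zero]
  · rintro ⟨l, h⟩
    refine ⟨l, ?_, fun l₁ hl => Fin.ext ?_⟩
    · simpa using (h l).symm
    · simpa [hl] using (h l₁).symm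

theorem GridArrow.ne {i j : GridVertex m} (h : GridArrow i j) : i ≠ j := by
  rintro rfl
  obtain ⟨l, h1, -⟩ := h
  omega

theorem GridVertex.ext_val {i j : GridVertex m} (h : ∀ l, (i l : ℕ) = j l) : i = j :=
  funext fun l => Fin.ext (h l)

/-- A path of length two raises two coordinates, so its middle vertex is determined by which one is
raised first. Thus a square has no third middle vertex, and each row of `extMap` has just two
nonzero blocks. -/
theorem eq_or_eq_of_squares {a b b₁ b₂ c : GridVertex m} (hb : b₁ ≠ b₂)
    (h : GridArrow a b) (h' : GridArrow b c) (h₁ : GridArrow a b₁) (h₁' : GridArrow b₁ c)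
    (h₂ : GridArrow a b₂) (h₂' : GridArrow b₂ c) : b = b₁ ∨ b = b₂ := by
  rw [gridArrow_iff] at *
  obtain ⟨l, h⟩ := h
  obtain ⟨l', h'⟩ := h'
  obtain ⟨l₁, h₁⟩ := h₁
  obtain ⟨l₁', h₁'⟩ := h₁'
  obtain ⟨l₂, h₂⟩ := h₂
  obtain ⟨l₂', h₂'⟩ := h₂'
  by_cases e1 : l = l₁
  · subst e1
    exact Or.inl (GridVertex.ext_val fun t => by rw [h, h₁])
  by_cases e2 : l = l₂
  · subst e2
    exact Or.inr (GridVertex.ext_val fun t => by rw [h, h₂])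
  exfalso
  have x1 := h l
  have x2 := h' l
  have x3 := h₁ l
  have x4 := h₁' l
  have x5 := h₂ l
  have x6 := h₂' l
  rw [if_pos rfl] at x1
  rw [if_neg e1] at x3
  rw [if_neg e2] at x5
  -- If `b` raises a coordinate `l` that neither `b₁` nor `b₂` raises, both of their second arrows
  -- must raise `l`, and then `b₁ = b₂`.
  have e3 : l = l₁' := by
    by_contra hne
    rw [if_neg hne] at x4
    omega
  have e4 : l = l₂' := by
    by_contra hne
    rw [if_neg hne] at x6
    omega
  subst e3
  subst e4
  exact hb (GridVertex.ext_val fun t => by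
    have y1 := h₁' t
    have y2 := h₂' t
    omega)

theorem gridLexLT_or {i j : GridVertex m} (h : i ≠ j) : GridLexLT i j ∨ GridLexLT j i := by
  classical
  have hne : ∃ l, i l ≠ j l := Function.ne_iff.1 h
  obtain ⟨l, hl, hmin⟩ := WellFounded.has_min (wellFounded_lt : WellFounded
    ((· < ·) : Fin d → Fin d → Prop)) {l | i l ≠ j l} hne
  have heq : ∀ l₁ < l, i l₁ = j l₁ := fun l₁ h₁ => by
    by_contra hcon
    exact hmin l₁ hcon h₁
  rcases lt_or_gt_of_ne hl with h' | h'
  · exact Or.inl ⟨l, h', heq⟩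
  · exact Or.inr ⟨l, h', fun l₁ h₁ => (heq l₁ h₁).symm⟩

theorem GridLexLT.asymm {i j : GridVertex m} (h : GridLexLT i j) : ¬GridLexLT j i := by
  rintro ⟨l', h1', h2'⟩
  obtain ⟨l, h1, h2⟩ := h
  rcases lt_trichotomy l l' with hl | rfl | hl
  · rw [h2' l hl] at h1
    exact lt_irrefl _ h1
  · exact lt_asymm h1 h1'
  · rw [h2 l' hl] at h1'
    exact lt_irrefl _ h1'

theorem GridLexLT.ne {i j : GridVertex m} (h : GridLexLT i j) : i ≠ j := by
  rintro rfl
  exact h.asymm h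

instance (i j : GridVertex m) : Subsingleton (i ⟶ j) :=
  inferInstanceAs (Subsingleton (PLift (GridArrow i j)))

theorem Path.le {i j : GridVertex m} (p : Quiver.Path i j) (l : Fin d) : (i l : ℕ) ≤ j l := by
  induction p with
  | nil => exact le_rfl
  | cons p a ih =>
    obtain ⟨l', h⟩ := gridArrow_iff.1 a.down
    have := h l
    omega

theorem GridArrow.sum_lt {i j : GridVertex m} (h : GridArrow i j) :
    ∑ l, (i l : ℕ) < ∑ l, (j l : ℕ) := by
  obtain ⟨l, h⟩ := gridArrow_iff.1 h
  refine Finset.sum_lt_sum (fun t _ => by rw [h]; omega) ⟨l, Finset.mem_univ _, ?_⟩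
  rw [h, if_pos rfl]
  omega

/-- Lower the coordinate `l` of a vertex by one. -/
def GridVertex.pred (i : GridVertex m) (l : Fin d) : GridVertex m := fun t =>
  if t = l then ⟨(i t : ℕ) - 1, lt_of_le_of_lt (Nat.sub_le _ _) (i t).2⟩ else i t

theorem GridVertex.pred_val (i : GridVertex m) (l t : Fin d) :
    (i.pred l t : ℕ) = i t - if t = l then 1 else 0 := by
  rw [GridVertex.pred]
  split_ifs <;> simp

theorem exists_path {i : GridVertex m} : ∀ (n : ℕ) {w : GridVertex m}, ∑ l, (w l : ℕ) = n →
    (∀ l, (i l : ℕ) ≤ w l) → Nonempty (Quiver.Path i w) := by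
  intro n
  induction n using Nat.strong_induction_on with
  | _ n ih =>
    intro w hn h
    by_cases he : ∀ l, (i l : ℕ) = w l
    · rw [GridVertex.ext_val he]
      exact ⟨.nil⟩
    · push Not at he
      obtain ⟨l, hl⟩ := he
      have hl' := h l
      have harr : GridArrow (w.pred l) w := gridArrow_iff.2 ⟨l, fun t => by
        rw [GridVertex.pred_val]
        split_ifs with ht
        · subst ht
          omega
        · omega⟩
      obtain ⟨p⟩ := ih _ (hn ▸ harr.sum_lt) rfl fun t => by
        rw [GridVertex.pred_val]
        have := h t
        split_ifs with ht
        · subst ht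
          omega
        · omega
      exact ⟨p.cons ⟨harr⟩⟩

theorem exists_square {i u u' j : GridVertex m} (hne : u ≠ u') (hu : GridArrow u j)
    (hu' : GridArrow u' j) (h : ∀ l, (i l : ℕ) ≤ u l) (h' : ∀ l, (i l : ℕ) ≤ u' l) :
    ∃ w, GridArrow w u ∧ GridArrow w u' ∧ ∀ l, (i l : ℕ) ≤ w l := by
  obtain ⟨l, hl⟩ := gridArrow_iff.1 hu
  obtain ⟨l', hl'⟩ := gridArrow_iff.1 hu'
  have hll : l ≠ l' := by
    rintro rfl
    refine hne (GridVertex.ext_val fun t => ?_)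
    have := hl t
    have := hl' t
    omega
  have key : ∀ t, (u.pred l' t : ℕ) + (if t = l then 1 else 0) + (if t = l' then 1 else 0) = j t ∧
      (i t : ℕ) ≤ u.pred l' t := by
    intro t
    rw [GridVertex.pred_val]
    have h1 := hl t
    have h2 := hl' t
    have h3 := h t
    have h4 := h' t
    by_cases e : t = l
    · rw [if_pos e] at h1 ⊢
      have e' : t ≠ l' := fun e' => hll (e.symm.trans e')
      rw [if_neg e'] at h2 ⊢
      omega
    · rw [if_neg e] at h1 ⊢
      split_ifs at h2 ⊢ <;> omega
  refine ⟨u.pred l', gridArrow_iff.2 ⟨l', fun t => ?_⟩, gridArrow_iff.2 ⟨l, fun t => ?_⟩,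
    fun t => (key t).2⟩
  · have := (key t).1
    have := hl t
    omega
  · have := (key t).1
    have := hl' t
    omega

/-! ### Commuting squares as relations of representations. -/

variable {K : Type*} [Field K] {ν : GridVertex m → ℕ}

/-- Parallel paths in the grid are related by flipping squares. The induction is on the coordinate
sum of the end point, comparing the last arrows of the two paths. -/
theorem satisfiesCommRel_of_squares {f : RepSpace K ν}
    (h : ∀ ⦃a b₁ b₂ c : GridVertex m⦄ (x₁ : a ⟶ b₁) (y₁ : b₁ ⟶ c) (x₂ : a ⟶ b₂) (y₂ : b₂ ⟶ c),
      b₁ ≠ b₂ → f y₁ * f x₁ = f y₂ * f x₂) : SatisfiesCommRel f := by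
  suffices hs : ∀ (n : ℕ) (i j : GridVertex m), ∑ l, (j l : ℕ) = n →
      ∀ p q : Quiver.Path i j, evalPath f p = evalPath f q from
    fun i j p q => hs _ i j rfl p q
  intro n
  induction n using Nat.strong_induction_on with
  | _ n ih =>
    intro i j hn p q
    have hirr : ∀ {u : GridVertex m}, Quiver.Path i u → (u ⟶ i) → False := by
      intro u r e
      obtain ⟨l, hl⟩ := gridArrow_iff.1 e.down
      have h1 := Path.le r l
      have h2 := hl l
      rw [if_pos rfl] at h2
      omega
    cases p with
    | nil =>
      cases q with
      | nil => rfl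
      | cons q e => exact (hirr q e).elim
    | @cons u _ p e =>
      cases q with
      | nil => exact (hirr p e).elim
      | @cons u' _ q e' =>
        simp only [evalPath]
        by_cases hu : u = u'
        · subst hu
          rw [ih _ (hn ▸ e.down.sum_lt) i u rfl p q, Subsingleton.elim e e']
        -- Both paths are rerouted through a common predecessor `w` of `u` and `u'` that is still
        -- reachable from `i`; they then differ by one square.
        · obtain ⟨w, hw, hw', hle⟩ := exists_square hu e.down e'.down (Path.le p) (Path.le q)
          obtain ⟨r⟩ := exists_path _ rfl hle
          rw [ih _ (hn ▸ e.down.sum_lt) i u rfl p (r.cons ⟨hw⟩),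
            ih _ (hn ▸ e'.down.sum_lt) i u' rfl q (r.cons ⟨hw'⟩)]
          simp only [evalPath]
          rw [← Matrix.mul_assoc, ← Matrix.mul_assoc, h _ e _ e' hu]

theorem SatisfiesCommRel.square {f : RepSpace K ν} (h : SatisfiesCommRel f)
    {a b₁ b₂ c : GridVertex m} (x₁ : a ⟶ b₁) (y₁ : b₁ ⟶ c) (x₂ : a ⟶ b₂) (y₂ : b₂ ⟶ c) :
    f y₁ * f x₁ = f y₂ * f x₂ := by
  simpa [evalPath] using h ((Quiver.Path.nil.cons x₁).cons y₁) ((Quiver.Path.nil.cons x₂).cons y₂)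

theorem extMap_apply {f : RepSpace K ν} {a b₁ b₂ : GridVertex m} (c : OutTwo a)
    (x₁ : a ⟶ b₁) (y₁ : b₁ ⟶ c.1) (x₂ : a ⟶ b₂) (y₂ : b₂ ⟶ c.1) (h : GridLexLT b₁ b₂)
    (v : (j : Quiver.Star a) → Fin (ν j.1) → K) :
    extMap f a v c = (f y₁).mulVec (v ⟨b₁, x₁⟩) - (f y₂).mulVec (v ⟨b₂, x₂⟩) := by
  classical
  have h1 : extBlock f a ⟨b₁, x₁⟩ c = f y₁ := by
    rw [extBlock, dif_pos ⟨y₁.down, b₂, x₂.down, h, y₂.down⟩]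
    rfl
  have h2 : extBlock f a ⟨b₂, x₂⟩ c = -f y₂ := by
    rw [extBlock, dif_neg, dif_pos ⟨y₂.down, b₁, x₁.down, h, y₁.down⟩]
    · rfl
    rintro ⟨-, j, hj, hlt, hj'⟩
    rcases eq_or_eq_of_squares h.ne hj hj' x₁.down y₁.down x₂.down y₂.down with rfl | rfl
    · exact h.asymm hlt
    · exact hlt.ne rfl
  simp only [extMap, LinearMap.pi_apply, LinearMap.sum_apply, LinearMap.comp_apply,
    LinearMap.proj_apply, Matrix.mulVecLin_apply]
  rw [Finset.sum_eq_add (⟨b₁, x₁⟩ : Quiver.Star a) ⟨b₂, x₂⟩]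
  · rw [h1, h2, Matrix.neg_mulVec, sub_eq_add_neg]
  · intro he
    exact h.ne (congrArg Sigma.fst he)
  · rintro ⟨b, x⟩ - ⟨hb1, hb2⟩
    have hb : ¬GridArrow b c.1 := by
      intro hbc
      rcases eq_or_eq_of_squares h.ne x.down hbc x₁.down y₁.down x₂.down y₂.down with rfl | rfl
      · exact hb1 (by rw [Subsingleton.elim x x₁])
      · exact hb2 (by rw [Subsingleton.elim x x₂])
    rw [extBlock, dif_neg fun hh => hb hh.1, dif_neg fun hh => hb hh.1, Matrix.zero_mulVec]
  · simp
  · simp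

/-- The lexicographic order only fixes signs, so the kernel has this symmetric description. -/
theorem mem_ker_extMap {f : RepSpace K ν} {a : GridVertex m}
    {v : (j : Quiver.Star a) → Fin (ν j.1) → K} :
    v ∈ LinearMap.ker (extMap f a) ↔ ∀ ⦃b₁ b₂ c : GridVertex m⦄ (x₁ : a ⟶ b₁) (y₁ : b₁ ⟶ c)
      (x₂ : a ⟶ b₂) (y₂ : b₂ ⟶ c), b₁ ≠ b₂ →
        (f y₁).mulVec (v ⟨b₁, x₁⟩) = (f y₂).mulVec (v ⟨b₂, x₂⟩) := by
  rw [LinearMap.mem_ker]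
  constructor
  · intro h b₁ b₂ c x₁ y₁ x₂ y₂ hb
    let c' : OutTwo a := ⟨c, b₁, b₂, x₁.down, x₂.down, hb, y₁.down, y₂.down⟩
    have hc := congrFun h c'
    rcases gridLexLT_or hb with hlt | hlt
    · rw [extMap_apply c' x₁ y₁ x₂ y₂ hlt] at hc
      exact sub_eq_zero.1 hc
    · rw [extMap_apply c' x₂ y₂ x₁ y₁ hlt] at hc
      exact (sub_eq_zero.1 hc).symm
  · intro h
    ext1 c
    obtain ⟨b₁, b₂, x₁, x₂, hb, y₁, y₂⟩ := c.2
    rcases gridLexLT_or hb with hlt | hlt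
    · rw [extMap_apply c ⟨x₁⟩ ⟨y₁⟩ ⟨x₂⟩ ⟨y₂⟩ hlt]
      exact sub_eq_zero.2 (h _ _ _ _ hb)
    · rw [extMap_apply c ⟨x₂⟩ ⟨y₂⟩ ⟨x₁⟩ ⟨y₁⟩ hlt]
      exact sub_eq_zero.2 (h _ _ _ _ hb.symm)

end Squares

/-! ### Regular families of subspaces -/

section RegKer

variable {k K : Type*} [Field k] [Field K] [Algebra k K] {X τ : Type*}

/-- A family of subspaces of `K^τ` cut out by linear forms whose coefficients are regular. -/
def IsRegKer (𝒜 : Subalgebra k (X → K)) (V : X → Submodule K (τ → K)) : Prop :=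
  ∃ (ρ : Type) (_ : Finite ρ) (q : ρ → X × (τ → K) → K), (∀ r, q r ∈ polyFun 𝒜 τ) ∧
    (∀ r x, IsLinearMap K fun u => q r (x, u)) ∧ ∀ x u, u ∈ V x ↔ ∀ r, q r (x, u) = 0

variable {𝒜 : Subalgebra k (X → K)}

theorem IsRegKer.exists_matrix [Fintype τ] {V : X → Submodule K (τ → K)} (hV : IsRegKer 𝒜 V) :
    ∃ (ρ : Type) (_ : Fintype ρ) (A : X → Matrix ρ τ K), RegMat 𝒜 A ∧
      ∀ x, V x = LinearMap.ker (A x).mulVecLin := by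
  classical
  obtain ⟨ρ, hρ, q, hq, hlin, hmem⟩ := hV
  refine ⟨ρ, Fintype.ofFinite ρ, fun x => Matrix.of fun r t => q r (x, Pi.single t 1), ?_, ?_⟩
  · intro r t
    refine polyFun_comp (π := fun x => x) (u := fun _ => Pi.single t 1) (fun a ha => ha) ?_ (hq r)
    intro t'
    by_cases h : t' = t
    · subst h
      simp only [Pi.single_eq_same]
      exact 𝒜.one_mem
    · simp only [Pi.single_eq_of_ne h]
      exact 𝒜.zero_mem
  · intro x
    ext u
    rw [hmem, LinearMap.mem_ker, funext_iff]
    refine forall_congr' fun r => ?_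
    have h1 : q r (x, u) = (IsLinearMap.mk' _ (hlin r x)) u := rfl
    rw [h1, LinearMap.pi_apply_eq_sum_univ]
    simp only [Matrix.mulVecLin_apply, Matrix.mulVec, dotProduct, Matrix.of_apply,
      IsLinearMap.mk'_apply, smul_eq_mul, Pi.zero_apply]
    have h2 : ∀ t : τ, (fun j => if t = j then (1 : K) else 0) = Pi.single t 1 := fun t => by
      ext j
      simp [Pi.single_apply, eq_comm]
    simp only [h2, mul_comm]

theorem IsRegKer.isOpen_finrank_le [Fintype τ] [Infinite K] [TopologicalSpace X]
    (hopen : ∀ a ∈ 𝒜, IsOpen {x | a x ≠ 0}) {V : X → Submodule K (τ → K)} (hV : IsRegKer 𝒜 V)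
    (c : ℕ) : IsOpen {x | Module.finrank K (V x) ≤ c} := by
  classical
  obtain ⟨ρ, _, A, hA, hVA⟩ := hV.exists_matrix
  obtain rfl : V = fun x => LinearMap.ker (A x).mulVecLin := funext hVA
  exact isOpen_finrank_ker_le hopen hA c

/-- The part over `S` of a family of subspaces, where `δ` does not vanish. -/
def subBundle (S : Set X) (V : X → Submodule K (τ → K)) (δ : X × (τ → K) → K) :
    Set (X × (τ → K)) :=
  {z | z.1 ∈ S ∧ z.2 ∈ V z.1 ∧ δ z ≠ 0}

/-- The form in which irreducibility is applied: `Φ` will parametrize a preimage under `ϖ₁` or `ϖ₂`,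
and localizing at `δ` makes inverse matrices regular. -/
theorem IsRegKer.isPreirreducible_range [Fintype τ] [Infinite K] [TopologicalSpace X]
    (hopen : ∀ a ∈ 𝒜, IsOpen {x | a x ≠ 0}) {S : Set X} (hS : IsPreirreducible S)
    {V : X → Submodule K (τ → K)} (hV : IsRegKer 𝒜 V) {c : ℕ}
    (hc : ∀ x ∈ S, Module.finrank K (V x) = c) {δ : X × (τ → K) → K} (hδ : δ ∈ polyFun 𝒜 τ)
    {Y : Type*} [TopologicalSpace Y] {Φ : subBundle S V δ → Y}
    (hΦ : @Continuous _ _ (funTop (locFun (polyFun 𝒜 τ) hδ (subBundle S V δ))) _ Φ) :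
    IsPreirreducible (Set.range Φ) := by
  obtain ⟨ρ, _, A, hA, hVA⟩ := hV.exists_matrix
  have h : subBundle S V δ = kerBundle S A δ := by
    ext z
    simp only [subBundle, kerBundle, hVA]
    rfl
  refine isPreirreducible_range_of_funTop ?_ hΦ
  rw [h]
  exact kerBundle_exists_ne_zero hopen hS hA (fun x hx => by rw [← hVA, hc x hx]) hδ

theorem IsRegKer.iInf_comap {ι : Type} [Finite ι] {σ : ι → Type*}
    {p : (s : ι) → X → Submodule K (σ s → K)} (hp : ∀ s, IsRegKer 𝒜 (p s))
    {l : (s : ι) → (τ → K) →ₗ[K] (σ s → K)}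
    (hl : ∀ s t, (fun z : X × (τ → K) => l s z.2 t) ∈ polyFun 𝒜 τ) :
    IsRegKer 𝒜 fun x => ⨅ s, (p s x).comap (l s) := by
  choose ρ hρ q hq hlin hmem using hp
  refine ⟨Σ s, ρ s, inferInstance, fun r z => q r.1 r.2 (z.1, l r.1 z.2), fun r => ?_,
    fun r x => ?_, fun x u => ?_⟩
  · exact polyFun_comp (fun a ha => fst_mem_polyFun ha) (hl r.1) (hq r.1 r.2)
  · exact ((IsLinearMap.mk' _ (hlin r.1 r.2 x)).comp (l r.1)).isLinear
  · simp only [Submodule.mem_iInf, Submodule.mem_comap, hmem]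
    exact ⟨fun h r => h r.1 r.2, fun h s r => h ⟨s, r⟩⟩

/-- Codimensions add up: the intersection is the kernel of the map from `E` to the product of the
quotients `F s ⧸ p s`, which is onto because the `l s` are jointly surjective. -/
theorem finrank_iInf_comap {ι : Type} [Fintype ι] {F : ι → Type*} [∀ s, AddCommGroup (F s)]
    [∀ s, Module K (F s)] [∀ s, FiniteDimensional K (F s)] {E : Type*} [AddCommGroup E]
    [Module K E] [FiniteDimensional K E] (p : (s : ι) → Submodule K (F s))
    (l : (s : ι) → E →ₗ[K] F s)
    (hl : Function.Surjective (LinearMap.pi l)) :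
    Module.finrank K (⨅ s, (p s).comap (l s) : Submodule K E) + ∑ s, Module.finrank K (F s) =
      ∑ s, Module.finrank K (p s) + Module.finrank K E := by
  let g : E →ₗ[K] ((s : ι) → F s ⧸ p s) := LinearMap.pi fun s => (p s).mkQ ∘ₗ l s
  have hker : LinearMap.ker g = ⨅ s, (p s).comap (l s) := by
    rw [LinearMap.ker_pi]
    simp [LinearMap.ker_comp]
  have hsurj : LinearMap.range g = ⊤ := by
    rw [LinearMap.range_eq_top]
    intro y
    choose x hx using fun s => (p s).mkQ_surjective (y s)
    obtain ⟨e, he⟩ := hl x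
    refine ⟨e, funext fun s => ?_⟩
    rw [← hx s, ← he]
    rfl
  have h1 := g.finrank_range_add_finrank_ker
  rw [hsurj, finrank_top, Module.finrank_pi_fintype, hker] at h1
  have h2 : ∑ s, Module.finrank K (F s) =
      ∑ s, Module.finrank K (F s ⧸ p s) + ∑ s, Module.finrank K (p s) := by
    rw [← Finset.sum_add_distrib]
    exact Finset.sum_congr rfl fun s _ => ((p s).finrank_quotient_add_finrank).symm
  omega

end RegKer

/-! ### The two families attached to a representation -/

section Families

variable {k K : Type*} [Field k] [Field K] [Algebra k K] {d : ℕ} {m : Fin d → ℕ}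
  {ν : GridVertex m → ℕ}

/-- The linear forms on `K^{ν_i}` that vanish on the image of the map into `i`. -/
def leftKer (f : RepSpace K ν) (i : GridVertex m) : Submodule K (Fin (ν i) → K) :=
  ⨅ a : Quiver.Costar i, LinearMap.ker (f a.2).vecMulLinear

theorem mem_leftKer {f : RepSpace K ν} {i : GridVertex m} {u : Fin (ν i) → K} :
    u ∈ leftKer f i ↔ ∀ ⦃j⦄ (a : j ⟶ i), Matrix.vecMul u (f a) = 0 := by
  simp only [leftKer, Submodule.mem_iInf, LinearMap.mem_ker, Matrix.vecMulLinear_apply]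
  exact ⟨fun h j a => h ⟨j, a⟩, fun h a => h a.2⟩

/-- `leftKer` is the dual of the cokernel. Unlike the cokernel, it is a kernel depending on `f`, as
the results on families require. The equality is row rank equals column rank for the matrix `M` of
all incoming arrows. -/
theorem finrank_leftKer (f : RepSpace K ν) (i : GridVertex m) :
    Module.finrank K (leftKer f i) = epsPoint f i := by
  let M : Matrix (Fin (ν i)) (Σ a : Quiver.Costar i, Fin (ν a.1)) K :=
    Matrix.of fun r c => f c.1.2 r c.2
  have h1 : leftKer f i = LinearMap.ker M.transpose.mulVecLin := by
    ext u
    rw [mem_leftKer, LinearMap.mem_ker]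
    constructor
    · intro h
      ext ⟨a, c⟩
      have := congrFun (h a.2) c
      simpa [M, Matrix.mulVec, Matrix.vecMul, dotProduct, mul_comm] using this
    · intro h j a
      ext c
      have := congrFun h ⟨⟨j, a⟩, c⟩
      simpa [M, Matrix.mulVec, Matrix.vecMul, dotProduct, mul_comm] using this
  have h2 : LinearMap.range (inMap f i) = LinearMap.range M.mulVecLin := by
    have h3 : ∀ v, inMap f i v = M.mulVecLin fun s => v s.1 s.2 := by
      intro v
      ext r
      simp [inMap, M, Matrix.mulVec, dotProduct, Finset.sum_apply, Fintype.sum_sigma]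
    ext y
    constructor
    · rintro ⟨v, rfl⟩
      exact ⟨_, (h3 v).symm⟩
    · rintro ⟨v, rfl⟩
      exact ⟨fun a c => v ⟨a, c⟩, h3 _⟩
  have h4 := rank_add_finrank_ker M.transpose
  rw [Matrix.rank_transpose, Fintype.card_fin, ← h1] at h4
  have h5 := (LinearMap.range (inMap f i)).finrank_quotient_add_finrank
  rw [Module.finrank_fintype_fun_eq_card, Fintype.card_fin, h2] at h5
  rw [Matrix.rank] at h4
  rw [epsPoint, h2]
  omega

theorem isRegKer_leftKer (i : GridVertex m) :
    IsRegKer (repAlg k K ν) fun f => leftKer f.1 i := by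
  refine ⟨Σ a : Quiver.Costar i, Fin (ν a.1), inferInstance,
    fun r z => Matrix.vecMul z.2 (z.1.1 r.1.2) r.2, fun r => ?_, fun r x => ?_, fun x u => ?_⟩
  · have h : (fun z : RepVariety k K ν × (Fin (ν i) → K) =>
        Matrix.vecMul z.2 (z.1.1 r.1.2) r.2) =
        ∑ t, (fun z => z.2 t) * fun z => z.1.1 r.1.2 t r.2 := by
      ext z
      simp [Matrix.vecMul, dotProduct, Finset.sum_apply]
    refine (congrArg (· ∈ polyFun (repAlg k K ν) _) h).mpr ?_
    exact sum_mem fun t _ => mul_mem (coord_mem_polyFun t)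
      (fst_mem_polyFun (regMat_repAlg r.1.2 t r.2))
  · exact ((LinearMap.proj r.2).comp (x.1 r.1.2).vecMulLinear).isLinear
  · rw [mem_leftKer]
    exact ⟨fun h r => congrFun (h r.1.2) r.2, fun h j a => funext fun c => h ⟨⟨j, a⟩, c⟩⟩

/-- The kernel of `extMap`, as a space of functions on a single index set. -/
def extKer (f : RepSpace K ν) (i : GridVertex m) :
    Submodule K ((Σ j : Quiver.Star i, Fin (ν j.1)) → K) :=
  LinearMap.ker (extMap f i ∘ₗ
    (LinearEquiv.piCurry K fun (j : Quiver.Star i) (_ : Fin (ν j.1)) => K).toLinearMap)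

theorem mem_extKer {f : RepSpace K ν} {i : GridVertex m}
    {u : (Σ j : Quiver.Star i, Fin (ν j.1)) → K} :
    u ∈ extKer f i ↔ extMap f i (fun j c => u ⟨j, c⟩) = 0 :=
  Iff.rfl

theorem finrank_extKer (f : RepSpace K ν) (i : GridVertex m) :
    Module.finrank K (extKer f i) = extDim f i := by
  rw [extKer, LinearMap.ker_comp, extDim]
  exact (LinearEquiv.ofSubmodule' _ _).finrank_eq

instance (i : GridVertex m) : Finite (OutTwo i) := inferInstanceAs (Finite (Subtype _))

theorem isRegKer_extKer (i : GridVertex m) :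
    IsRegKer (repAlg k K ν) fun f => extKer f.1 i := by
  refine ⟨Σ c : OutTwo i, Fin (ν c.1), inferInstance,
    fun r z => extMap z.1.1 i (fun j c => z.2 ⟨j, c⟩) r.1 r.2, fun r => ?_, fun r x => ?_,
    fun x u => ?_⟩
  · have h : (fun z : RepVariety k K ν × ((Σ j : Quiver.Star i, Fin (ν j.1)) → K) =>
        extMap z.1.1 i (fun j c => z.2 ⟨j, c⟩) r.1 r.2) =
        ∑ j : Quiver.Star i, ∑ t : Fin (ν j.1), (fun z => extBlock z.1.1 i j r.1 r.2 t) *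
          fun z => z.2 ⟨j, t⟩ := by
      ext z
      simp [extMap, Matrix.mulVec, dotProduct, Finset.sum_apply]
    refine (congrArg (· ∈ polyFun (repAlg k K ν) _) h).mpr ?_
    refine sum_mem fun j _ => sum_mem fun t _ => mul_mem ?_ (coord_mem_polyFun _)
    refine fst_mem_polyFun (a := fun f : RepVariety k K ν => extBlock f.1 i j r.1 r.2 t) ?_
    unfold extBlock
    split_ifs with h1 h2
    · exact regMat_repAlg _ _ _
    · exact neg_mem (regMat_repAlg _ _ _)
    · exact zero_mem _
  · exact ((LinearMap.proj r.2).comp ((LinearMap.proj r.1).comp (extMap x.1 i ∘ₗ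
      (LinearEquiv.piCurry K
        fun (j : Quiver.Star i) (_ : Fin (ν j.1)) => K).toLinearMap))).isLinear
  · rw [mem_extKer]
    exact ⟨fun h r => congrFun (congrFun h r.1) r.2,
      fun h => funext fun c => funext fun t => h ⟨c, t⟩⟩

theorem isOpen_epsPoint_le [Infinite K] (i : GridVertex m) (c : ℕ) :
    IsOpen {f : RepVariety k K ν | epsPoint f.1 i ≤ c} := by
  simpa only [finrank_leftKer] using
    (isRegKer_leftKer (k := k) (K := K) (ν := ν) i).isOpen_finrank_le (fun _ => isOpen_repAlg) c

theorem isOpen_extDim_le [Infinite K] (i : GridVertex m) (c : ℕ) :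
    IsOpen {f : RepVariety k K ν | extDim f.1 i ≤ c} := by
  simpa only [finrank_extKer] using
    (isRegKer_extKer (k := k) (K := K) (ν := ν) i).isOpen_finrank_le (fun _ => isOpen_repAlg) c

end Families

/-! ### Splitting off a direct summand -/

section Splitting

variable (K : Type*) [Field K] {a b n : ℕ} (h : n = a + b)

/-- The decomposition of an index set of size `a + b`. -/
def splitEquiv (h : n = a + b) : Fin a ⊕ Fin b ≃ Fin n :=
  finSumFinEquiv.trans (finCongr h.symm)

/-- The inclusion of the first summand. -/
def inclL : Matrix (Fin n) (Fin a) K :=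
  (1 : Matrix (Fin n) (Fin n) K).submatrix id fun c => splitEquiv h (Sum.inl c)

/-- The inclusion of the second summand. -/
def inclR : Matrix (Fin n) (Fin b) K :=
  (1 : Matrix (Fin n) (Fin n) K).submatrix id fun c => splitEquiv h (Sum.inr c)

/-- The projection to the first summand. -/
def projL : Matrix (Fin a) (Fin n) K :=
  (1 : Matrix (Fin n) (Fin n) K).submatrix (fun c => splitEquiv h (Sum.inl c)) id

/-- The projection to the second summand. -/
def projR : Matrix (Fin b) (Fin n) K :=
  (1 : Matrix (Fin n) (Fin n) K).submatrix (fun c => splitEquiv h (Sum.inr c)) id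

variable {K}

theorem projR_mul {c : Type*} (M : Matrix (Fin n) c K) :
    projR K h * M = M.submatrix (fun t => splitEquiv h (Sum.inr t)) id := by
  ext r s
  simp [projR, Matrix.mul_apply, Matrix.one_apply]

theorem projL_mul {c : Type*} (M : Matrix (Fin n) c K) :
    projL K h * M = M.submatrix (fun t => splitEquiv h (Sum.inl t)) id := by
  ext r s
  simp [projL, Matrix.mul_apply, Matrix.one_apply]

theorem projL_mul_inclL : projL K h * inclL K h = 1 := by
  ext r s
  simp [projL_mul, inclL, Matrix.one_apply]

theorem projL_mul_inclR : projL K h * inclR K h = 0 := by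
  ext r s
  simp [projL_mul, inclR]

theorem projR_mul_inclL : projR K h * inclL K h = 0 := by
  ext r s
  simp [projR_mul, inclL]

theorem projR_mul_inclR : projR K h * inclR K h = 1 := by
  ext r s
  simp [projR_mul, inclR, Matrix.one_apply]

theorem inclL_mul_projL_add : inclL K h * projL K h + inclR K h * projR K h = 1 := by
  ext r s
  rw [Matrix.add_apply, Matrix.mul_apply, Matrix.mul_apply]
  have h1 := Fintype.sum_sum_type fun x : Fin a ⊕ Fin b =>
    (1 : Matrix (Fin n) (Fin n) K) r (splitEquiv h x) *
      (1 : Matrix (Fin n) (Fin n) K) (splitEquiv h x) s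
  have h2 := (splitEquiv h).sum_comp fun t => (1 : Matrix (Fin n) (Fin n) K) r t *
    (1 : Matrix (Fin n) (Fin n) K) t s
  rw [h2, ← Matrix.mul_apply, Matrix.one_mul] at h1
  exact h1.symm

theorem inclL_mul_projL (hb : b = 0) : inclL K h * projL K h = 1 := by
  subst hb
  have h1 := inclL_mul_projL_add (K := K) h
  rwa [show inclR K h * projR K h = 0 by ext; simp [Matrix.mul_apply], add_zero] at h1

variable {k : Type*} [Field k] [Algebra k K] {Z : Type*} {ℬ : Subalgebra k (Z → K)}

theorem regMat_inclL : RegMat ℬ fun _ => inclL K h := fun r _ => RegMat.one r _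

theorem regMat_projL : RegMat ℬ fun _ => projL K h := fun _ c => RegMat.one _ c

theorem regMat_projR : RegMat ℬ fun _ => projR K h := fun _ c => RegMat.one _ c

theorem regMat_restrict {Y m n : Type*} {𝒬 : Subalgebra k (Y → K)} {δ : Y → K} (hδ : δ ∈ 𝒬)
    {W : Set Y} {M : Y → Matrix m n K} (hM : RegMat 𝒬 M) :
    RegMat (locFun 𝒬 hδ W) fun z => M z :=
  fun r c => restrict_mem_locFun hδ (hM r c)

/-- Inverting the product of all determinants inverts each of them: times the product, the inverse
of one determinant is the product of the others. -/
theorem regMat_inv {Y ι : Type*} [Fintype ι] {n : ι → Type*} [∀ j, Fintype (n j)]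
    [∀ j, DecidableEq (n j)] {𝒬 : Subalgebra k (Y → K)} {M : (j : ι) → Y → Matrix (n j) (n j) K}
    (hM : ∀ j, RegMat 𝒬 (M j)) (hδ : (fun y => ∏ j, (M j y).det) ∈ 𝒬) {W : Set Y}
    (hW : ∀ y ∈ W, ∏ j, (M j y).det ≠ 0) (j : ι) :
    RegMat (locFun 𝒬 hδ W) fun z => (M j z)⁻¹ := by
  classical
  have h1 : (fun z : W => ((M j z).det)⁻¹) ∈ locFun 𝒬 hδ W := by
    refine ⟨1, ∏ t ∈ Finset.univ.erase j, fun y => (M t y).det,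
      prod_mem fun t _ => (hM t).det, fun z => ?_⟩
    have h2 : (M j z).det ≠ 0 := fun h0 => hW z z.2 (Finset.prod_eq_zero (Finset.mem_univ j) h0)
    change (∏ j, (M j z).det) ^ 1 * ((M j z).det)⁻¹ = _
    rw [pow_one, ← Finset.mul_prod_erase _ _ (Finset.mem_univ j), Finset.prod_apply,
      mul_right_comm, mul_inv_cancel₀ h2, one_mul]
  simp only [Matrix.inv_def, Ring.inverse_eq_inv']
  exact (regMat_restrict hδ (hM j).adjugate).smul h1

end Splitting

/-! ### Extensions in coordinates -/

theorem mulVecLin_injective_of_mul_eq_one {K : Type*} [Field K] {a n : ℕ}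
    {A : Matrix (Fin n) (Fin a) K} {B : Matrix (Fin a) (Fin n) K} (h : B * A = 1) :
    Function.Injective A.mulVecLin := by
  intro v w hvw
  have h1 := congrArg B.mulVec hvw
  simpa [Matrix.mulVec_mulVec, h] using h1

theorem mulVecLin_surjective_of_mul_eq_one {K : Type*} [Field K] {a n : ℕ}
    {A : Matrix (Fin a) (Fin n) K} {B : Matrix (Fin n) (Fin a) K} (h : A * B = 1) :
    Function.Surjective A.mulVecLin := by
  intro v
  refine ⟨B.mulVec v, ?_⟩
  simp [Matrix.mulVec_mulVec, h]

namespace ExtVariety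

variable {k K : Type*} [Field k] [Field K] [Algebra k K] {d : ℕ} {m : Fin d → ℕ}
  {ν₁ ν ν₂ : GridVertex m → ℕ}

/-- The coarsest topology making both projections continuous is enough: only these two maps are
used, and continuity of a parametrization need only be checked on the subrepresentation and the
middle term. -/
instance : TopologicalSpace (ExtVariety k K ν₁ ν ν₂) :=
  TopologicalSpace.induced (fun x => (x.toSub, x.toMid)) inferInstance

theorem continuous_toSub_toMid :
    Continuous fun x : ExtVariety k K ν₁ ν ν₂ => (x.toSub, x.toMid) :=
  continuous_induced_dom

theorem continuous_toSub : Continuous (toSub : ExtVariety k K ν₁ ν ν₂ → _) :=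
  continuous_toSub_toMid.fst

theorem continuous_toMid : Continuous (toMid : ExtVariety k K ν₁ ν ν₂ → _) :=
  continuous_toSub_toMid.snd

theorem ext_of {x y : ExtVariety k K ν₁ ν ν₂} (h₁ : ∀ j, x.inc j = y.inc j)
    (h₂ : ∀ j, x.quo j = y.quo j)
    (h₃ : ∀ ⦃i j : GridVertex m⦄ (a : i ⟶ j), x.rep a = y.rep a) : x = y := by
  have e₁ := funext h₁
  have e₂ := funext h₂
  have e₃ : x.rep = y.rep := by
    funext i j a
    exact h₃ a
  cases x
  cases y
  subst e₁ e₂ e₃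
  rfl

theorem subRep_eq (x : ExtVariety k K ν₁ ν ν₂) {i j : GridVertex m} (a : i ⟶ j)
    {f : Matrix (Fin (ν₁ j)) (Fin (ν₁ i)) K} (h : x.inc j * f = x.rep a * x.inc i) :
    x.subRep a = f :=
  x.inc_mul_cancel (by rw [subRep_spec, h])

variable (hν : ∀ j, ν j = ν₁ j + ν₂ j)

/-- The extension obtained from the standard splitting by a change of basis. -/
def ofConj (g g' : (j : GridVertex m) → Matrix (Fin (ν j)) (Fin (ν j)) K)
    (hg : ∀ j, g j * g' j = 1) (h : RepSpace K ν) (hh : SatisfiesCommRel h) (f : RepSpace K ν₁)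
    (hf : ∀ ⦃i j⦄ (a : i ⟶ j), g j * inclL K (hν j) * f a = h a * (g i * inclL K (hν i))) :
    ExtVariety k K ν₁ ν ν₂ where
  inc j := g j * inclL K (hν j)
  quo j := projR K (hν j) * g' j
  rep := h
  inc_injective j := mulVecLin_injective_of_mul_eq_one (B := projL K (hν j) * g' j) (by
    rw [Matrix.mul_assoc, ← Matrix.mul_assoc (g' j), mul_eq_one_comm.1 (hg j), Matrix.one_mul,
      projL_mul_inclL])
  exact j := by
    have hg' := mul_eq_one_comm.1 (hg j)
    refine le_antisymm ?_ ?_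
    · rw [LinearMap.range_le_ker_iff, ← Matrix.mulVecLin_mul, Matrix.mul_assoc,
        ← Matrix.mul_assoc (g' j), hg', Matrix.one_mul, projR_mul_inclL, Matrix.mulVecLin_zero]
    · intro v hv
      rw [LinearMap.mem_ker, Matrix.mulVecLin_apply, ← Matrix.mulVec_mulVec] at hv
      refine ⟨(projL K (hν j)).mulVec ((g' j).mulVec v), ?_⟩
      have h1 := congrArg (fun M => (g j).mulVec (M.mulVec ((g' j).mulVec v)))
        (inclL_mul_projL_add (K := K) (hν j))
      simp only [Matrix.add_mulVec, ← Matrix.mulVec_mulVec, hv, Matrix.mulVec_zero, add_zero,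
        Matrix.one_mulVec] at h1
      rw [Matrix.mulVecLin_apply, ← Matrix.mulVec_mulVec, h1, Matrix.mulVec_mulVec, hg j,
        Matrix.one_mulVec]
  quo_surjective j := mulVecLin_surjective_of_mul_eq_one (B := g j * inclR K (hν j)) (by
    rw [Matrix.mul_assoc, ← Matrix.mul_assoc (g' j), mul_eq_one_comm.1 (hg j), Matrix.one_mul,
      projR_mul_inclR])
  comm := hh
  stable i j a := by
    rw [← Matrix.mulVecLin_mul, ← hf, Matrix.mulVecLin_mul]
    exact LinearMap.range_comp_le_range _ _

theorem toSub_ofConj {g g' : (j : GridVertex m) → Matrix (Fin (ν j)) (Fin (ν j)) K}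
    (hg : ∀ j, g j * g' j = 1) {h : RepSpace K ν} (hh : SatisfiesCommRel h) {f : RepSpace K ν₁}
    (hf : ∀ ⦃i j⦄ (a : i ⟶ j), g j * inclL K (hν j) * f a = h a * (g i * inclL K (hν i)))
    ⦃i j : GridVertex m⦄ (a : i ⟶ j) : (ofConj (k := k) hν g g' hg h hh f hf).toSub.1 a = f a :=
  subRep_eq _ _ (hf a)

/-- Exact sequences of vector spaces split: `g` is the given inclusion on the first summand and a
section of the quotient map on the second. -/
theorem exists_conj (x : ExtVariety k K ν₁ ν ν₂) :
    ∃ g : (j : GridVertex m) → Matrix (Fin (ν j)) (Fin (ν j)) K, ∀ j, (g j).det ≠ 0 ∧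
      x.inc j = g j * inclL K (hν j) ∧ x.quo j * g j = projR K (hν j) := by
  suffices hs : ∀ j, ∃ g : Matrix (Fin (ν j)) (Fin (ν j)) K, g.det ≠ 0 ∧
      x.inc j = g * inclL K (hν j) ∧ x.quo j * g = projR K (hν j) by
    choose g hg using hs
    exact ⟨g, hg⟩
  intro j
  obtain ⟨s, hs⟩ := LinearMap.exists_rightInverse_of_surjective _
    (LinearMap.range_eq_top.2 (x.quo_surjective j))
  have hqs : x.quo j * LinearMap.toMatrix' s = 1 := by
    have h2 := congrArg LinearMap.toMatrix' hs
    rwa [LinearMap.toMatrix'_comp, LinearMap.toMatrix'_id, ← Matrix.toLin'_apply',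
      LinearMap.toMatrix'_toLin'] at h2
  have hqi : x.quo j * x.inc j = 0 := by
    have h2 := LinearMap.range_le_ker_iff.1 (x.exact j).le
    rwa [← Matrix.mulVecLin_mul, ← Matrix.toLin'_apply', LinearEquiv.map_eq_zero_iff] at h2
  set g := x.inc j * projL K (hν j) + LinearMap.toMatrix' s * projR K (hν j) with hg
  have h1 : x.quo j * g = projR K (hν j) := by
    rw [hg, Matrix.mul_add, ← Matrix.mul_assoc, ← Matrix.mul_assoc, hqi, hqs, Matrix.zero_mul,
      Matrix.one_mul, zero_add]
  have h2 : g * inclL K (hν j) = x.inc j := by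
    rw [hg, Matrix.add_mul, Matrix.mul_assoc, Matrix.mul_assoc, projL_mul_inclL, projR_mul_inclL,
      Matrix.mul_zero, Matrix.mul_one, add_zero]
  refine ⟨g, ?_, h2.symm, h1⟩
  rw [← isUnit_iff_ne_zero, ← Matrix.isUnit_iff_isUnit_det, ← Matrix.mulVec_injective_iff_isUnit]
  change Function.Injective g.mulVecLin
  rw [← LinearMap.ker_eq_bot, LinearMap.ker_eq_bot']
  intro v hv
  rw [Matrix.mulVecLin_apply] at hv
  have h3 : (projR K (hν j)).mulVec v = 0 := by
    rw [← h1, ← Matrix.mulVec_mulVec, hv, Matrix.mulVec_zero]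
  have h4 : (projL K (hν j)).mulVec v = 0 := by
    refine x.inc_injective j ?_
    rw [hg, Matrix.add_mulVec, ← Matrix.mulVec_mulVec, ← Matrix.mulVec_mulVec, h3,
      Matrix.mulVec_zero, add_zero] at hv
    rw [Matrix.mulVecLin_apply, hv, map_zero]
  have h5 := congrArg (fun M => M.mulVec v) (inclL_mul_projL_add (K := K) (hν j))
  simpa [Matrix.add_mulVec, ← Matrix.mulVec_mulVec, h3, h4] using h5.symm

end ExtVariety

/-! ### Irreducibility of the two projections of the extension variety -/

section FunLeft

variable {K : Type*} [Field K] {τ ι : Type} {σ : ι → Type}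

theorem surjective_pi_funLeft (φ : (s : ι) → σ s → τ)
    (hφ : Function.Injective fun p : Σ s, σ s => φ p.1 p.2) :
    Function.Surjective (LinearMap.pi fun s => LinearMap.funLeft K K (φ s)) := by
  intro y
  refine ⟨Function.extend (fun p : Σ s, σ s => φ p.1 p.2) (fun p => y p.1 p.2) 0, ?_⟩
  ext s t
  exact hφ.extend_apply (fun p : Σ s, σ s => y p.1 p.2) 0 ⟨s, t⟩

theorem finrank_iInf_comap_funLeft [Fintype ι] [∀ s, Fintype (σ s)] [Fintype τ]
    (φ : (s : ι) → σ s → τ) (hφ : Function.Injective fun p : Σ s, σ s => φ p.1 p.2)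
    (p : (s : ι) → Submodule K (σ s → K)) :
    Module.finrank K (⨅ s, (p s).comap (LinearMap.funLeft K K (φ s)) : Submodule K (τ → K)) =
      ∑ s, Module.finrank K (p s) + Fintype.card τ - ∑ s, Fintype.card (σ s) := by
  have h := finrank_iInf_comap p _ (surjective_pi_funLeft (K := K) φ hφ)
  simp only [Module.finrank_fintype_fun_eq_card] at h
  omega

end FunLeft

theorem eq_inclL_mul_of_block {K : Type*} [Field K] {a b n a' b' n' : ℕ} (h : n = a + b)
    (h' : n' = a' + b') {M : Matrix (Fin n') (Fin n) K} {f : Matrix (Fin a') (Fin a) K}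
    (h₁ : M * inclL K h = inclL K h' * f) (h₂ : projR K h' * M * inclR K h = 0) :
    M = inclL K h' * (f * projL K h + projL K h' * M * inclR K h * projR K h) := by
  have e1 : M = M * (inclL K h * projL K h + inclR K h * projR K h) := by
    rw [inclL_mul_projL_add, Matrix.mul_one]
  have e2 : M * inclR K h =
      (inclL K h' * projL K h' + inclR K h' * projR K h') * (M * inclR K h) := by
    rw [inclL_mul_projL_add, Matrix.one_mul]
  rw [Matrix.mul_assoc] at h₂
  rw [Matrix.add_mul, Matrix.mul_assoc (inclR K h'), h₂, Matrix.mul_zero, add_zero,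
    Matrix.mul_assoc] at e2
  rw [Matrix.mul_add, ← Matrix.mul_assoc, h₁, ← Matrix.mul_assoc, e2] at e1
  rw [Matrix.mul_add]
  simpa only [Matrix.mul_assoc] using e1

section Extensions

variable {k K : Type*} [Field k] [Field K] [Algebra k K] {d : ℕ} {m : Fin d → ℕ}
  {ν₁ ν : GridVertex m → ℕ} {i : GridVertex m}

theorem single_eq_zero {j : GridVertex m} (h : j ≠ i) :
    (Pi.single i 1 : GridVertex m → ℕ) j = 0 :=
  Pi.single_eq_of_ne h 1

theorem eq_of_fin_single {j : GridVertex m} (r : Fin ((Pi.single i 1 : GridVertex m → ℕ) j)) :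
    j = i := by
  by_contra h
  exact Nat.not_lt_zero _ (lt_of_lt_of_eq r.2 (single_eq_zero h))

theorem sum_fin_single (p : GridVertex m → ℕ) :
    ∑ s : Σ j : GridVertex m, Fin ((Pi.single i 1 : GridVertex m → ℕ) j), p s.1 = p i := by
  rw [Fintype.sum_sigma]
  simp only [Finset.sum_const, Finset.card_univ, Fintype.card_fin, smul_eq_mul]
  rw [Finset.sum_eq_single i]
  · simp
  · intro j _ hj
    rw [single_eq_zero hj, zero_mul]
  · simp

instance : Fintype (Quiver.Total (GridVertex m)) :=
  Fintype.ofEquiv (Σ (i : GridVertex m) (j : GridVertex m), i ⟶ j)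
    { toFun := fun x => ⟨x.1, x.2.1, x.2.2⟩
      invFun := fun x => ⟨x.left, x.right, x.hom⟩ }

variable (hν : ∀ j, ν j = ν₁ j + (Pi.single i 1 : GridVertex m → ℕ) j)

variable (ν) in
/-- Indices of the entries of a matrix at every vertex. -/
abbrev GroupIdx : Type := Σ j : GridVertex m, Fin (ν j) × Fin (ν j)

/-- The endomorphism at the vertex `j` with given entries. -/
def groupMat {τ : Type} (ι : GroupIdx ν → τ) (u : τ → K) (j : GridVertex m) :
    Matrix (Fin (ν j)) (Fin (ν j)) K :=
  Matrix.of fun r c => u (ι ⟨j, r, c⟩)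

theorem regMat_groupMat {X : Type*} {𝒜 : Subalgebra k (X → K)} {τ : Type} (ι : GroupIdx ν → τ)
    (j : GridVertex m) : RegMat (polyFun 𝒜 τ) fun z => groupMat ι z.2 j :=
  fun _ _ => coord_mem_polyFun _

/-- The product of the determinants at all vertices. -/
def groupDet {X : Type*} {τ : Type} (ι : GroupIdx ν → τ) (z : X × (τ → K)) : K :=
  ∏ j, (groupMat ι z.2 j).det

theorem groupDet_mem {X : Type*} {𝒜 : Subalgebra k (X → K)} {τ : Type} (ι : GroupIdx ν → τ) :
    groupDet ι ∈ polyFun 𝒜 τ := by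
  have h : groupDet ι = ∏ j, fun z : X × (τ → K) => (groupMat ι z.2 j).det := by
    ext z
    simp [groupDet, Finset.prod_apply]
  rw [h]
  exact prod_mem fun j _ => (regMat_groupMat ι j).det

theorem det_ne_zero_of_groupDet {X : Type*} {τ : Type} {ι : GroupIdx ν → τ} {z : X × (τ → K)}
    (h : groupDet ι z ≠ 0) (j : GridVertex m) : (groupMat ι z.2 j).det ≠ 0 :=
  fun h0 => h (Finset.prod_eq_zero (Finset.mem_univ j) h0)

/-! #### The subrepresentation is given -/

/-- Indices of the parameters of extensions of a given representation. -/
abbrev ExtIdx (ν₁ ν : GridVertex m → ℕ) (i : GridVertex m) : Type :=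
  (Σ a : Quiver.Total (GridVertex m),
    Fin (ν₁ a.right) × Fin ((Pi.single i 1 : GridVertex m → ℕ) a.left)) ⊕ GroupIdx ν

/-- The positions of the entries that describe the arrows from the new basis vector. -/
def extIdx (s : Σ j : GridVertex m, Fin ((Pi.single i 1 : GridVertex m → ℕ) j))
    (t : Σ j : Quiver.Star s.1, Fin (ν₁ j.1)) : ExtIdx ν₁ ν i :=
  Sum.inl ⟨⟨s.1, t.1.1, t.1.2⟩, t.2, s.2⟩

theorem extIdx_injective : Function.Injective
    fun p : Σ s : (Σ j : GridVertex m, Fin ((Pi.single i 1 : GridVertex m → ℕ) j)),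
      (Σ j : Quiver.Star s.1, Fin (ν₁ j.1)) => (extIdx p.1 p.2 : ExtIdx ν₁ ν i) := by
  rintro ⟨⟨j, r⟩, ⟨⟨j₁, a⟩, c⟩⟩ ⟨⟨j', r'⟩, ⟨⟨j₁', a'⟩, c'⟩⟩ h
  simp only [extIdx, Sum.inl.injEq, Sigma.mk.injEq, Quiver.Total.mk.injEq] at h
  obtain ⟨⟨rfl, rfl, ha⟩, h⟩ := h
  obtain rfl := eq_of_heq ha
  obtain ⟨rfl, rfl⟩ := Prod.mk.inj (eq_of_heq h)
  rfl

/-- The parameters of the extensions of a given representation. -/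
def extFamily (ν : GridVertex m → ℕ) (i : GridVertex m) (f : RepSpace K ν₁) :
    Submodule K (ExtIdx ν₁ ν i → K) :=
  ⨅ s : Σ j : GridVertex m, Fin ((Pi.single i 1 : GridVertex m → ℕ) j),
    (extKer f s.1).comap (LinearMap.funLeft K K (extIdx s))

theorem isRegKer_extFamily :
    IsRegKer (repAlg k K ν₁) fun f => extFamily ν i f.1 :=
  IsRegKer.iInf_comap (fun s => isRegKer_extKer s.1) fun _ _ => coord_mem_polyFun _

/-- What matters is that the dimension depends on `f` only through `extDim f i`, so it is constant
on the minimal locus. -/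
theorem finrank_extFamily (f : RepSpace K ν₁) : Module.finrank K (extFamily ν i f) =
    extDim f i + Fintype.card (ExtIdx ν₁ ν i) -
      ∑ s : Σ j : GridVertex m, Fin ((Pi.single i 1 : GridVertex m → ℕ) j),
        Fintype.card (Σ j : Quiver.Star s.1, Fin (ν₁ j.1)) := by
  rw [extFamily, finrank_iInf_comap_funLeft _ extIdx_injective]
  simp only [finrank_extKer]
  rw [sum_fin_single (i := i) fun j => extDim f j]

/-- The arrows from the new basis vector. -/
def extPart (u : ExtIdx ν₁ ν i → K) ⦃a b : GridVertex m⦄ (x : a ⟶ b) :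
    Matrix (Fin (ν₁ b)) (Fin ((Pi.single i 1 : GridVertex m → ℕ) a)) K :=
  Matrix.of fun r c => u (Sum.inl ⟨⟨a, b, x⟩, r, c⟩)

theorem mem_extFamily {f : RepSpace K ν₁} {u : ExtIdx ν₁ ν i → K} :
    u ∈ extFamily ν i f ↔ ∀ ⦃a b₁ b₂ c : GridVertex m⦄ (x₁ : a ⟶ b₁) (y₁ : b₁ ⟶ c)
      (x₂ : a ⟶ b₂) (y₂ : b₂ ⟶ c), b₁ ≠ b₂ → f y₁ * extPart u x₁ = f y₂ * extPart u x₂ := by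
  have h1 : u ∈ extFamily ν i f ↔
      ∀ s : Σ j : GridVertex m, Fin ((Pi.single i 1 : GridVertex m → ℕ) j),
        (fun (j : Quiver.Star s.1) c => extPart u j.2 c s.2) ∈ LinearMap.ker (extMap f s.1) := by
    rw [extFamily, Submodule.mem_iInf]
    rfl
  rw [h1]
  simp only [mem_ker_extMap]
  constructor
  · intro h a b₁ b₂ c x₁ y₁ x₂ y₂ hb
    ext r t
    exact congrFun (h ⟨a, t⟩ x₁ y₁ x₂ y₂ hb) r
  · intro h s b₁ b₂ c x₁ y₁ x₂ y₂ hb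
    ext r
    exact congrFun (congrFun (h x₁ y₁ x₂ y₂ hb) r) s.2

/-- The extension of `f` in the standard basis. -/
def extRep (f : RepSpace K ν₁) (u : ExtIdx ν₁ ν i → K) : RepSpace K ν := fun a b x =>
  inclL K (hν b) * (f x * projL K (hν a) + extPart u x * projR K (hν a))

theorem extRep_mul (f : RepSpace K ν₁) (u : ExtIdx ν₁ ν i → K) ⦃a b c : GridVertex m⦄
    (x : a ⟶ b) (y : b ⟶ c) : extRep hν f u y * extRep hν f u x =
      inclL K (hν c) * (f y * f x * projL K (hν a) + f y * extPart u x * projR K (hν a)) := by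
  rw [extRep, extRep, Matrix.mul_assoc, ← Matrix.mul_assoc (f y * _ + _), Matrix.add_mul,
    Matrix.mul_assoc, Matrix.mul_assoc, projL_mul_inclL, projR_mul_inclL, Matrix.mul_one,
    Matrix.mul_zero, add_zero, Matrix.mul_add, Matrix.mul_assoc, Matrix.mul_assoc]

theorem extRep_mul_inclL (f : RepSpace K ν₁) (u : ExtIdx ν₁ ν i → K) ⦃a b : GridVertex m⦄
    (x : a ⟶ b) : extRep hν f u x * inclL K (hν a) = inclL K (hν b) * f x := by
  rw [extRep, Matrix.mul_assoc, Matrix.add_mul, Matrix.mul_assoc, Matrix.mul_assoc,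
    projL_mul_inclL, projR_mul_inclL, Matrix.mul_one, Matrix.mul_zero, add_zero]

/-- Change of basis. -/
def conjRep (g g' : (j : GridVertex m) → Matrix (Fin (ν j)) (Fin (ν j)) K) (h : RepSpace K ν) :
    RepSpace K ν := fun a b x => g b * h x * g' a

theorem conjRep_satisfiesCommRel {g g' : (j : GridVertex m) → Matrix (Fin (ν j)) (Fin (ν j)) K}
    (hg : ∀ j, g' j * g j = 1) {h : RepSpace K ν}
    (hh : ∀ ⦃a b₁ b₂ c : GridVertex m⦄ (x₁ : a ⟶ b₁) (y₁ : b₁ ⟶ c) (x₂ : a ⟶ b₂) (y₂ : b₂ ⟶ c),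
      b₁ ≠ b₂ → h y₁ * h x₁ = h y₂ * h x₂) : SatisfiesCommRel (conjRep g g' h) := by
  have key : ∀ ⦃a b c : GridVertex m⦄ (x : a ⟶ b) (y : b ⟶ c),
      conjRep g g' h y * conjRep g g' h x = g c * (h y * h x) * g' a := by
    intro a b c x y
    have : g c * h y * g' b * (g b * h x * g' a) =
        g c * (h y * (g' b * g b) * h x) * g' a := by
      simp only [Matrix.mul_assoc]
    rw [conjRep, conjRep, this, hg, Matrix.mul_one]
  exact satisfiesCommRel_of_squares fun a b₁ b₂ c x₁ y₁ x₂ y₂ hb => by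
    rw [key, key, hh x₁ y₁ x₂ y₂ hb]

/-- The extension with given parameters. -/
def extOfParam (f : RepVariety k K ν₁) (u : ExtIdx ν₁ ν i → K) (hu : u ∈ extFamily ν i f.1)
    (hdet : ∀ j, (groupMat Sum.inr u j).det ≠ 0) : ExtVariety k K ν₁ ν (Pi.single i 1) :=
  .ofConj hν (groupMat Sum.inr u) (fun j => (groupMat Sum.inr u j)⁻¹)
    (fun j => Matrix.mul_nonsing_inv _ (hdet j).isUnit)
    (conjRep (groupMat Sum.inr u) (fun j => (groupMat Sum.inr u j)⁻¹) (extRep hν f.1 u))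
    (conjRep_satisfiesCommRel (fun j => Matrix.nonsing_inv_mul _ (hdet j).isUnit)
      fun a b₁ b₂ c x₁ y₁ x₂ y₂ hb => by
        rw [extRep_mul, extRep_mul, f.2.square x₁ y₁ x₂ y₂, mem_extFamily.1 hu x₁ y₁ x₂ y₂ hb])
    f.1 fun a b x => by
      rw [conjRep, Matrix.mul_assoc _ _ (groupMat _ u a * _), ← Matrix.mul_assoc _ (groupMat _ u a),
        Matrix.nonsing_inv_mul _ (hdet a).isUnit, Matrix.one_mul, Matrix.mul_assoc,
        Matrix.mul_assoc, extRep_mul_inclL]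

theorem toSub_extOfParam (f : RepVariety k K ν₁) (u : ExtIdx ν₁ ν i → K)
    (hu : u ∈ extFamily ν i f.1) (hdet : ∀ j, (groupMat Sum.inr u j).det ≠ 0) :
    (extOfParam hν f u hu hdet).toSub = f :=
  Subtype.ext (by
    funext a b x
    exact ExtVariety.toSub_ofConj hν _ _ _ x)

theorem exists_extOfParam (x : ExtVariety k K ν₁ ν (Pi.single i 1)) :
    ∃ u hu hdet, extOfParam hν x.toSub u hu hdet = x := by
  obtain ⟨g, hg⟩ := x.exists_conj hν
  have hdet : ∀ j, IsUnit (g j).det := fun j => (hg j).1.isUnit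
  let h' : RepSpace K ν := fun a b y => (g b)⁻¹ * x.rep y * g a
  -- In the adapted basis, the parameters are the block from the quotient to the subrepresentation,
  -- together with the entries of `g`.
  let u : ExtIdx ν₁ ν i → K := Sum.elim
    (fun t => (projL K (hν t.1.right) * h' t.1.hom * inclR K (hν t.1.left)) t.2.1 t.2.2)
    fun t => g t.1 t.2.1 t.2.2
  have hug : groupMat Sum.inr u = g := rfl
  have huw : ∀ ⦃a b⦄ (y : a ⟶ b), extPart u y = projL K (hν b) * h' y * inclR K (hν a) :=
    fun a b y => rfl
  have hinc : ∀ ⦃a b⦄ (y : a ⟶ b), h' y * inclL K (hν a) = inclL K (hν b) * x.toSub.1 y := by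
    intro a b y
    have h1 := x.subRep_spec y
    rw [(hg a).2.1, (hg b).2.1] at h1
    change (g b)⁻¹ * x.rep y * g a * inclL K (hν a) = _
    rw [Matrix.mul_assoc, Matrix.mul_assoc, ← h1, Matrix.mul_assoc, ← Matrix.mul_assoc,
      Matrix.nonsing_inv_mul _ (hdet b), Matrix.one_mul]
    rfl
  -- The quotient lives at the single vertex `i`, and no arrow is a loop.
  have hR : ∀ ⦃a b⦄ (y : a ⟶ b), projR K (hν b) * h' y * inclR K (hν a) = 0 := by
    intro a b y
    ext r c
    exact (y.down.ne ((eq_of_fin_single c).trans (eq_of_fin_single r).symm)).elim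
  have hrep : extRep hν x.toSub.1 u = h' := by
    funext a b y
    exact (eq_inclL_mul_of_block (hν a) (hν b) (hinc y) (hR y)).symm
  have hrep2 : conjRep g (fun j => (g j)⁻¹) h' = x.rep := by
    funext a b y
    change g b * ((g b)⁻¹ * x.rep y * g a) * (g a)⁻¹ = _
    rw [Matrix.mul_assoc (g b)⁻¹, ← Matrix.mul_assoc, Matrix.mul_nonsing_inv _ (hdet b),
      Matrix.one_mul, Matrix.mul_assoc, Matrix.mul_nonsing_inv _ (hdet a), Matrix.mul_one]
  have hu : u ∈ extFamily ν i x.toSub.1 := by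
    refine mem_extFamily.2 fun a b₁ b₂ c x₁ y₁ x₂ y₂ hb => ?_
    have hsq : h' y₁ * h' x₁ = h' y₂ * h' x₂ := by
      have key : ∀ ⦃b⦄ (p : a ⟶ b) (q : b ⟶ c),
          h' q * h' p = (g c)⁻¹ * (x.rep q * x.rep p) * g a := by
        intro b p q
        have : (g c)⁻¹ * x.rep q * g b * ((g b)⁻¹ * x.rep p * g a) =
            (g c)⁻¹ * (x.rep q * (g b * (g b)⁻¹) * x.rep p) * g a := by
          simp only [Matrix.mul_assoc]
        change (g c)⁻¹ * x.rep q * g b * ((g b)⁻¹ * x.rep p * g a) = _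
        rw [this, Matrix.mul_nonsing_inv _ (hdet b), Matrix.mul_one]
      rw [key, key, x.comm.square x₁ y₁ x₂ y₂]
    -- The condition defining `extFamily` is the block of the square relation that leads from the
    -- quotient to the subrepresentation.
    have h3 := congrArg (fun M => projL K (hν c) * M * inclR K (hν a)) hsq
    have h4 : ∀ M : Matrix (Fin (ν₁ c)) (Fin ((Pi.single i 1 : GridVertex m → ℕ) a)) K,
        ∀ N : Matrix (Fin (ν₁ c)) (Fin (ν₁ a)) K, projL K (hν c) * (inclL K (hν c) *
        (N * projL K (hν a) + M * projR K (hν a))) * inclR K (hν a) = M := by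
      intro M N
      rw [← Matrix.mul_assoc, projL_mul_inclL, Matrix.one_mul, Matrix.add_mul, Matrix.mul_assoc,
        Matrix.mul_assoc, projL_mul_inclR, projR_mul_inclR, Matrix.mul_zero, Matrix.mul_one,
        zero_add]
    rw [← hrep, extRep_mul, extRep_mul] at h3
    simpa only [h4] using h3
  refine ⟨u, hu, fun j => by rw [hug]; exact (hg j).1, ?_⟩
  refine ExtVariety.ext_of (fun j => (hg j).2.1.symm) (fun j => ?_) fun a b y => ?_
  · change projR K (hν j) * (g j)⁻¹ = _
    rw [← (hg j).2.2, Matrix.mul_assoc, Matrix.mul_nonsing_inv _ (hdet j), Matrix.mul_one]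
  · change conjRep g (fun j => (g j)⁻¹) (extRep hν x.toSub.1 u) y = _
    rw [hrep, hrep2]

theorem exists_toSub_eq
    (hν : ∀ j, ν j = ν₁ j + (Pi.single i 1 : GridVertex m → ℕ) j)
    (f : RepVariety k K ν₁) :
    ∃ x : ExtVariety k K ν₁ ν (Pi.single i 1), x.toSub = f := by
  -- The split extension in the standard basis.
  let u : ExtIdx ν₁ ν i → K :=
    Sum.elim 0 fun t => (1 : Matrix (Fin (ν t.1)) (Fin (ν t.1)) K) t.2.1 t.2.2
  have hug : ∀ j, groupMat Sum.inr u j = 1 := fun j => rfl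
  have hw : ∀ ⦃a b⦄ (x : a ⟶ b), extPart u x = 0 := fun a b x => rfl
  exact ⟨_, toSub_extOfParam hν f u (mem_extFamily.2 fun a b₁ b₂ c x₁ y₁ x₂ y₂ _ => by
    rw [hw, hw, Matrix.mul_zero, Matrix.mul_zero]) fun j => by simp [hug]⟩

/-- The preimage is the image of the bundle with fibres `extFamily`, restricted to invertible base
changes; the hypothesis on `extDim` makes the fibre dimension constant. -/
theorem isPreirreducible_toSub_preimage
    (hν : ∀ j, ν j = ν₁ j + (Pi.single i 1 : GridVertex m → ℕ) j)
    [Infinite K] {S : Set (RepVariety k K ν₁)}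
    (hS : IsPreirreducible S) {c : ℕ} (hc : ∀ f ∈ S, extDim f.1 i = c) :
    IsPreirreducible ((ExtVariety.toSub : ExtVariety k K ν₁ ν (Pi.single i 1) → _) ⁻¹' S) := by
  let W := subBundle S (fun f : RepVariety k K ν₁ => extFamily ν i f.1) (groupDet Sum.inr)
  let Φ : W → ExtVariety k K ν₁ ν (Pi.single i 1) := fun z =>
    extOfParam hν z.1.1 z.1.2 z.2.2.1 (det_ne_zero_of_groupDet z.2.2.2)
  have hrange : Set.range Φ = ExtVariety.toSub ⁻¹' S := by
    ext x
    constructor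
    · rintro ⟨z, rfl⟩
      rw [Set.mem_preimage, toSub_extOfParam]
      exact z.2.1
    · intro hx
      obtain ⟨u, hu, hdet, hxu⟩ := exists_extOfParam hν x
      exact ⟨⟨(x.toSub, u), hx, hu, Finset.prod_ne_zero_iff.2 fun j _ => hdet j⟩, hxu⟩
  rw [← hrange]
  refine isRegKer_extFamily.isPreirreducible_range (fun _ => isOpen_repAlg) hS
    (fun f hf => (finrank_extFamily f.1).trans (by rw [hc f hf])) (groupDet_mem Sum.inr) ?_
  let _ := funTop (locFun (polyFun (repAlg k K ν₁) (ExtIdx ν₁ ν i)) (groupDet_mem Sum.inr) W)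
  have hW : ∀ z ∈ W, ∏ j, (groupMat (Sum.inr : GroupIdx ν → ExtIdx ν₁ ν i) z.2 j).det ≠ 0 :=
    fun z hz => hz.2.2
  have hrep : ∀ ⦃a b : GridVertex m⦄ (x : a ⟶ b), RegMat (polyFun (repAlg k K ν₁) (ExtIdx ν₁ ν i))
      fun z => z.1.1 x := fun a b x r c => fst_mem_polyFun (regMat_repAlg x r c)
  refine continuous_induced_rng.2 (Continuous.prodMk ?_ ?_)
  · refine continuous_funTop_of_regMat fun a b x => ?_
    have h1 : ∀ z, (Φ z).toSub = z.1.1 := fun z => toSub_extOfParam _ _ _ _ _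
    simp only [h1]
    exact regMat_restrict (groupDet_mem Sum.inr) (hrep x)
  · refine continuous_funTop_of_regMat fun a b x => ?_
    change RegMat _ fun z : W => groupMat Sum.inr z.1.2 b * (inclL K (hν b) *
      (z.1.1.1 x * projL K (hν a) + extPart z.1.2 x * projR K (hν a))) *
        (groupMat Sum.inr z.1.2 a)⁻¹
    refine RegMat.mul (RegMat.mul (regMat_restrict (groupDet_mem Sum.inr) (regMat_groupMat _ b))
      ((regMat_inclL _).mul (((regMat_restrict (groupDet_mem Sum.inr) (hrep x)).mul
        (regMat_projL _)).add (RegMat.mul ?_ (regMat_projR _))))) ?_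
    · exact fun r c => restrict_mem_locFun (groupDet_mem Sum.inr) (coord_mem_polyFun _)
    · exact regMat_inv (fun j => regMat_groupMat _ j) (groupDet_mem Sum.inr) hW a

end Extensions

section Extensions

variable {k K : Type*} [Field k] [Field K] [Algebra k K] {d : ℕ} {m : Fin d → ℕ}
  {ν₁ ν : GridVertex m → ℕ} {i : GridVertex m}
  (hν : ∀ j, ν j = ν₁ j + (Pi.single i 1 : GridVertex m → ℕ) j)

/-! #### The middle term is given -/

/-- The positions of the entries that describe the linear form defining a subrepresentation. -/
def midIdx (s : Σ j : GridVertex m, Fin ((Pi.single i 1 : GridVertex m → ℕ) j))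
    (t : Fin (ν s.1)) : GroupIdx ν :=
  ⟨s.1, splitEquiv (hν s.1) (Sum.inr s.2), t⟩

theorem midIdx_injective : Function.Injective
    fun p : Σ s : (Σ j : GridVertex m, Fin ((Pi.single i 1 : GridVertex m → ℕ) j)),
      Fin (ν s.1) => midIdx hν p.1 p.2 := by
  rintro ⟨⟨j, r⟩, c⟩ ⟨⟨j', r'⟩, c'⟩ h
  simp only [midIdx, Sigma.mk.injEq] at h
  obtain ⟨rfl, h⟩ := h
  obtain ⟨h1, rfl⟩ := Prod.mk.inj (eq_of_heq h)
  obtain rfl := Sum.inr_injective ((splitEquiv _).injective h1)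
  rfl

/-- The parameters of the subrepresentations of a given representation. -/
def midFamily (h : RepSpace K ν) : Submodule K (GroupIdx ν → K) :=
  ⨅ s : Σ j : GridVertex m, Fin ((Pi.single i 1 : GridVertex m → ℕ) j),
    (leftKer h s.1).comap (LinearMap.funLeft K K (midIdx hν s))

theorem isRegKer_midFamily : IsRegKer (repAlg k K ν) fun h => midFamily hν h.1 :=
  IsRegKer.iInf_comap (fun s => isRegKer_leftKer s.1) fun _ _ => coord_mem_polyFun _

theorem finrank_midFamily (h : RepSpace K ν) : Module.finrank K (midFamily hν h) =
    epsPoint h i + Fintype.card (GroupIdx ν) -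
      ∑ s : Σ j : GridVertex m, Fin ((Pi.single i 1 : GridVertex m → ℕ) j),
        Fintype.card (Fin (ν s.1)) := by
  rw [midFamily, finrank_iInf_comap_funLeft _ (midIdx_injective hν)]
  simp only [finrank_leftKer]
  rw [sum_fin_single (i := i) fun j => epsPoint h j]

theorem mem_midFamily {h : RepSpace K ν} {u : GroupIdx ν → K} :
    u ∈ midFamily hν h ↔ ∀ ⦃a b : GridVertex m⦄ (x : a ⟶ b),
      projR K (hν b) * groupMat id u b * h x = 0 := by
  rw [midFamily, Submodule.mem_iInf]
  simp only [Submodule.mem_comap, mem_leftKer, projR_mul]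
  constructor
  · intro H a b x
    ext r c
    exact congrFun (H ⟨b, r⟩ x) c
  · intro H s a x
    ext c
    exact congrFun (congrFun (H x) s.2) c

/-- The extension with given middle term and parameters. -/
def subOfParam (h : RepVariety k K ν) (u : GroupIdx ν → K) (hu : u ∈ midFamily hν h.1)
    (hdet : ∀ j, (groupMat id u j).det ≠ 0) : ExtVariety k K ν₁ ν (Pi.single i 1) :=
  -- Here the parameter is the inverse of the base change. The quotient map is then `projR` times
  -- the parameter, so its vanishing on incoming arrows is a linear condition on `u`.
  .ofConj hν (fun j => (groupMat id u j)⁻¹) (groupMat id u)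
    (fun j => Matrix.nonsing_inv_mul _ (hdet j).isUnit) h.1 h.2
    (fun a b x => projL K (hν b) * (groupMat id u b * h.1 x *
      ((groupMat id u a)⁻¹ * inclL K (hν a))))
    fun a b x => by
      have h1 : groupMat id u b * h.1 x =
          inclL K (hν b) * (projL K (hν b) * (groupMat id u b * h.1 x)) := by
        have h2 := congrArg (fun M => M * (groupMat id u b * h.1 x))
          (inclL_mul_projL_add (K := K) (hν b))
        have h3 := mem_midFamily hν |>.1 hu x
        rw [Matrix.mul_assoc] at h3
        simp only [Matrix.add_mul, Matrix.mul_assoc, h3, Matrix.mul_zero, add_zero,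
          Matrix.one_mul] at h2
        exact h2.symm
      have h4 : (groupMat id u b)⁻¹ * (groupMat id u b * h.1 x) = _ :=
        congrArg ((groupMat id u b)⁻¹ * ·) h1
      rw [← Matrix.mul_assoc, Matrix.nonsing_inv_mul _ (hdet b).isUnit, Matrix.one_mul] at h4
      conv_rhs => rw [h4]
      simp only [Matrix.mul_assoc]

theorem toMid_subOfParam (h : RepVariety k K ν) (u : GroupIdx ν → K) (hu : u ∈ midFamily hν h.1)
    (hdet : ∀ j, (groupMat id u j).det ≠ 0) : (subOfParam hν h u hu hdet).toMid = h :=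
  rfl

theorem toSub_subOfParam (h : RepVariety k K ν) (u : GroupIdx ν → K) (hu : u ∈ midFamily hν h.1)
    (hdet : ∀ j, (groupMat id u j).det ≠ 0) ⦃a b : GridVertex m⦄ (x : a ⟶ b) :
    (subOfParam hν h u hu hdet).toSub.1 x = projL K (hν b) * (groupMat id u b * h.1 x *
      ((groupMat id u a)⁻¹ * inclL K (hν a))) :=
  ExtVariety.toSub_ofConj hν _ _ _ x

theorem exists_inc_mul_eq_one
    (hν : ∀ j, ν j = ν₁ j + (Pi.single i 1 : GridVertex m → ℕ) j)
    (x : ExtVariety k K ν₁ ν (Pi.single i 1)) {j : GridVertex m}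
    (hj : j ≠ i) : ∃ p : Matrix (Fin (ν₁ j)) (Fin (ν j)) K, x.inc j * p = 1 := by
  obtain ⟨g, hg⟩ := x.exists_conj hν
  refine ⟨projL K (hν j) * (g j)⁻¹, ?_⟩
  rw [(hg j).2.1, Matrix.mul_assoc, ← Matrix.mul_assoc (inclL K _),
    inclL_mul_projL _ (single_eq_zero hj), Matrix.one_mul,
    Matrix.mul_nonsing_inv _ (hg j).1.isUnit]

theorem exists_mul_inc_eq_one
    (hν : ∀ j, ν j = ν₁ j + (Pi.single i 1 : GridVertex m → ℕ) j)
    (x : ExtVariety k K ν₁ ν (Pi.single i 1)) (j : GridVertex m) :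
    ∃ p : Matrix (Fin (ν₁ j)) (Fin (ν j)) K, p * x.inc j = 1 := by
  obtain ⟨g, hg⟩ := x.exists_conj hν
  refine ⟨projL K (hν j) * (g j)⁻¹, ?_⟩
  rw [(hg j).2.1, Matrix.mul_assoc, ← Matrix.mul_assoc _ (g j),
    Matrix.nonsing_inv_mul _ (hg j).1.isUnit, Matrix.one_mul, projL_mul_inclL]

/-- The quotient has no nonzero arrows. For an arrow into `i`, the inclusion at its source is
invertible, so its image lies in the subrepresentation. -/
theorem quo_mul_rep
    (hν : ∀ j, ν j = ν₁ j + (Pi.single i 1 : GridVertex m → ℕ) j)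
    (x : ExtVariety k K ν₁ ν (Pi.single i 1)) ⦃a b : GridVertex m⦄ (y : a ⟶ b) :
    x.quo b * x.rep y = 0 := by
  by_cases hb : b = i
  · have ha : a ≠ i := fun ha => y.down.ne (ha.trans hb.symm)
    obtain ⟨p, hp⟩ := exists_inc_mul_eq_one hν x ha
    have hqi : x.quo b * x.inc b = 0 := by
      obtain ⟨g, hg⟩ := x.exists_conj hν
      rw [(hg b).2.1, ← Matrix.mul_assoc, (hg b).2.2, projR_mul_inclL]
    rw [← Matrix.mul_one (x.rep y), ← hp, ← Matrix.mul_assoc (x.rep y), ← x.subRep_spec,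
      Matrix.mul_assoc, ← Matrix.mul_assoc, hqi, Matrix.zero_mul]
  · ext r
    exact (hb (eq_of_fin_single r)).elim

theorem exists_subOfParam (x : ExtVariety k K ν₁ ν (Pi.single i 1)) :
    ∃ u hu hdet, subOfParam hν x.toMid u hu hdet = x := by
  obtain ⟨g, hg⟩ := x.exists_conj hν
  have hdet : ∀ j, IsUnit (g j).det := fun j => (hg j).1.isUnit
  let u : GroupIdx ν → K := fun t => (g t.1)⁻¹ t.2.1 t.2.2
  have hug : ∀ j, groupMat id u j = (g j)⁻¹ := fun j => rfl
  have hq : ∀ j, projR K (hν j) * (g j)⁻¹ = x.quo j := fun j => by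
    rw [← (hg j).2.2, Matrix.mul_assoc, Matrix.mul_nonsing_inv _ (hdet j), Matrix.mul_one]
  have hu : u ∈ midFamily hν x.toMid.1 := (mem_midFamily hν).2 fun a b y => by
    rw [hug, hq]
    exact quo_mul_rep hν x y
  refine ⟨u, hu, fun j => ?_, ?_⟩
  · rw [hug]
    exact (Matrix.isUnit_nonsing_inv_det _ (hdet j)).ne_zero
  refine ExtVariety.ext_of (fun j => ?_) (fun j => hq j) fun a b y => rfl
  change (groupMat id u j)⁻¹ * inclL K (hν j) = _
  rw [hug, Matrix.nonsing_inv_nonsing_inv _ (hdet j), (hg j).2.1]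

theorem isPreirreducible_toMid_preimage
    (hν : ∀ j, ν j = ν₁ j + (Pi.single i 1 : GridVertex m → ℕ) j)
    [Infinite K] {S : Set (RepVariety k K ν)}
    (hS : IsPreirreducible S) {c : ℕ} (hc : ∀ f ∈ S, epsPoint f.1 i = c) :
    IsPreirreducible ((ExtVariety.toMid : ExtVariety k K ν₁ ν (Pi.single i 1) → _) ⁻¹' S) := by
  let W := subBundle S (fun f : RepVariety k K ν => midFamily hν f.1) (groupDet id)
  let Φ : W → ExtVariety k K ν₁ ν (Pi.single i 1) := fun z =>
    subOfParam hν z.1.1 z.1.2 z.2.2.1 (det_ne_zero_of_groupDet z.2.2.2)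
  have hrange : Set.range Φ = ExtVariety.toMid ⁻¹' S := by
    ext x
    constructor
    · rintro ⟨z, rfl⟩
      exact z.2.1
    · intro hx
      obtain ⟨u, hu, hdet, hxu⟩ := exists_subOfParam hν x
      exact ⟨⟨(x.toMid, u), hx, hu, Finset.prod_ne_zero_iff.2 fun j _ => hdet j⟩, hxu⟩
  rw [← hrange]
  refine (isRegKer_midFamily hν).isPreirreducible_range (fun _ => isOpen_repAlg) hS
    (fun f hf => (finrank_midFamily hν f.1).trans (by rw [hc f hf])) (groupDet_mem id) ?_
  let _ := funTop (locFun (polyFun (repAlg k K ν) (GroupIdx ν)) (groupDet_mem id) W)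
  have hW : ∀ z ∈ W, ∏ j, (groupMat (id : GroupIdx ν → GroupIdx ν) z.2 j).det ≠ 0 :=
    fun z hz => hz.2.2
  have hrep : ∀ ⦃a b : GridVertex m⦄ (x : a ⟶ b), RegMat (polyFun (repAlg k K ν) (GroupIdx ν))
      fun z => z.1.1 x := fun a b x r c => fst_mem_polyFun (regMat_repAlg x r c)
  refine continuous_induced_rng.2 (Continuous.prodMk ?_ ?_)
  · refine continuous_funTop_of_regMat fun a b x => ?_
    have h1 : (fun z : W => (Φ z).toSub.1 x) = fun z : W => projL K (hν b) *
        (groupMat id z.1.2 b * z.1.1.1 x * ((groupMat id z.1.2 a)⁻¹ * inclL K (hν a))) :=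
      funext fun z => toSub_subOfParam hν _ _ _ _ x
    refine (congrArg (RegMat _) h1).mpr ?_
    exact (regMat_projL _).mul (((regMat_restrict (groupDet_mem id) (regMat_groupMat _ b)).mul
      (regMat_restrict (groupDet_mem id) (hrep x))).mul
        ((regMat_inv (fun j => regMat_groupMat _ j) (groupDet_mem id) hW a).mul (regMat_inclL _)))
  · exact continuous_funTop_of_regMat fun a b x => regMat_restrict (groupDet_mem id) (hrep x)

/-- Linear forms at `i` are restricted to the subspace. Since the inclusion is invertible at the
source of every arrow into `i`, a form kills the incoming arrows of the middle term exactly when its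
restriction kills those of the subrepresentation. Restriction is onto with a kernel of dimension
one. -/
theorem epsPoint_toMid
    (hν : ∀ j, ν j = ν₁ j + (Pi.single i 1 : GridVertex m → ℕ) j)
    (x : ExtVariety k K ν₁ ν (Pi.single i 1)) :
    epsPoint x.toMid.1 i = epsPoint x.toSub.1 i + 1 := by
  have h1 : leftKer x.rep i =
      ⨅ _ : Unit, (leftKer x.subRep i).comap (x.inc i).vecMulLinear := by
    ext u
    rw [iInf_const, mem_leftKer, Submodule.mem_comap, mem_leftKer]
    refine forall_congr' fun a => forall_congr' fun y => ?_
    rw [Matrix.vecMulLinear_apply, Matrix.vecMul_vecMul, x.subRep_spec, ← Matrix.vecMul_vecMul]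
    constructor
    · intro h
      rw [h, Matrix.zero_vecMul]
    · intro h
      obtain ⟨p, hp⟩ := exists_inc_mul_eq_one hν x y.down.ne
      have h2 := congrArg (fun w => Matrix.vecMul w p) h
      rwa [Matrix.vecMul_vecMul, hp, Matrix.vecMul_one, Matrix.zero_vecMul] at h2
  have h2 := finrank_iInf_comap (fun _ : Unit => leftKer x.subRep i)
    (fun _ => (x.inc i).vecMulLinear) (by
      intro w
      obtain ⟨p, hp⟩ := exists_mul_inc_eq_one hν x i
      refine ⟨Matrix.vecMul (w ()) p, funext fun _ => ?_⟩
      simp [Matrix.vecMul_vecMul, hp])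
  rw [← h1, finrank_leftKer] at h2
  simp only [Finset.univ_unique, Finset.sum_const, Finset.card_singleton, one_smul,
    finrank_leftKer, Module.finrank_fintype_fun_eq_card, Fintype.card_fin] at h2
  have h3 := hν i
  rw [Pi.single_eq_same] at h3
  change epsPoint x.rep i = epsPoint x.subRep i + 1
  omega

theorem exists_matrix_row_eq {n : ℕ} {v : Fin n → K} (hv : v ≠ 0) (r : Fin n) :
    ∃ M : Matrix (Fin n) (Fin n) K, M.det ≠ 0 ∧ M r = v := by
  obtain ⟨c, hc⟩ := Function.ne_iff.1 hv
  -- With `v` as row `c` of the identity the determinant is `v c ≠ 0`; exchanging two rows moves `v`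
  -- to row `r` and only affects the sign.
  refine ⟨((1 : Matrix (Fin n) (Fin n) K).updateRow c v).submatrix (Equiv.swap r c) id, ?_, ?_⟩
  · rw [Matrix.det_permute]
    refine mul_ne_zero ?_ ?_
    · rcases Int.units_eq_one_or (Equiv.Perm.sign (Equiv.swap r c)) with h | h <;> rw [h] <;> simp
    · rw [← Matrix.det_transpose, ← Matrix.updateCol_transpose, Matrix.transpose_one,
        ← Matrix.cramer_apply, Matrix.cramer_one]
      exact hc
  · ext t
    simp

/-- A nonzero linear form on the cokernel exists and is completed to an invertible matrix at `i`;
its kernel is the hyperplane wanted. -/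
theorem exists_toMid_eq
    (hν : ∀ j, ν j = ν₁ j + (Pi.single i 1 : GridVertex m → ℕ) j)
    {h : RepVariety k K ν} (hh : 0 < epsPoint h.1 i) :
    ∃ x : ExtVariety k K ν₁ ν (Pi.single i 1), x.toMid = h := by
  have key : ∀ j, ∃ M : Matrix (Fin (ν j)) (Fin (ν j)) K, M.det ≠ 0 ∧
      ∀ ⦃a⦄ (x : a ⟶ j), projR K (hν j) * M * h.1 x = 0 := by
    intro j
    by_cases hj : j = i
    · subst hj
      rw [← finrank_leftKer, Module.finrank_pos_iff_exists_ne_zero] at hh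
      obtain ⟨⟨v, hv⟩, hv0⟩ := hh
      have h1 : (Pi.single j 1 : GridVertex m → ℕ) j = 1 := Pi.single_eq_same j 1
      let r₀ : Fin ((Pi.single j 1 : GridVertex m → ℕ) j) := ⟨0, by rw [h1]; exact one_pos⟩
      obtain ⟨M, hM, hMr⟩ := exists_matrix_row_eq (v := v) (fun h0 => hv0 (Subtype.ext h0))
        (splitEquiv (hν j) (Sum.inr r₀))
      refine ⟨M, hM, fun a x => ?_⟩
      ext r c
      have hr : r = r₀ := Fin.ext (by
        have h2 := lt_of_lt_of_eq r.2 h1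
        exact Nat.lt_one_iff.1 h2)
      rw [projR_mul, hr]
      have h3 := congrFun (mem_leftKer.1 hv x) c
      rw [← hMr] at h3
      exact h3
    · refine ⟨1, by simp, fun a x => ?_⟩
      ext r
      exact (hj (eq_of_fin_single r)).elim
  choose M hM hM' using key
  let u : GroupIdx ν → K := fun t => M t.1 t.2.1 t.2.2
  have hu : ∀ j, groupMat id u j = M j := fun j => rfl
  exact ⟨_, toMid_subOfParam hν h u ((mem_midFamily hν).2 fun a b x => by rw [hu, hM'])
    fun j => by rw [hu]; exact hM j⟩

end Extensions

/-! ### The Kashiwara operators -/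

section Operators

variable {k K : Type*} [Field k] [Field K] [Algebra k K] {d : ℕ} {m : Fin d → ℕ}
  {ν : GridVertex m → ℕ}

theorem exists_min_of_nonempty {X : Type*} {Λ : Set X} (h : Λ.Nonempty) (p : X → ℕ) :
    ∃ f ∈ Λ, ∀ g ∈ Λ, p f ≤ p g := by
  obtain ⟨f, hf, hmin⟩ := WellFounded.has_min (measure p).wf Λ h
  exact ⟨f, hf, fun g hg => not_lt.1 (hmin g hg)⟩

theorem exists_epsPoint_eq_epsMin {Λ : Set (RepVariety k K ν)} (h : Λ.Nonempty)
    (i : GridVertex m) : ∃ f ∈ Λ, epsPoint f.1 i = epsMin Λ i := by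
  obtain ⟨f, hf, he⟩ := Nat.sInf_mem (h.image fun f => epsPoint f.1 i)
  exact ⟨f, hf, he⟩

theorem epsMin_le {Λ : Set (RepVariety k K ν)} {f : RepVariety k K ν} (hf : f ∈ Λ)
    (i : GridVertex m) : epsMin Λ i ≤ epsPoint f.1 i :=
  Nat.sInf_le ⟨f, hf, rfl⟩

theorem mem_epsMinLocus_iff {Λ : Set (RepVariety k K ν)} {f : RepVariety k K ν} (hf : f ∈ Λ)
    (i : GridVertex m) : f ∈ epsMinLocus Λ i ↔ epsPoint f.1 i = epsMin Λ i := by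
  constructor
  · rintro ⟨-, h⟩
    obtain ⟨g, hg, he⟩ := exists_epsPoint_eq_epsMin ⟨f, hf⟩ i
    exact le_antisymm (he ▸ h g hg) (epsMin_le hf i)
  · intro h
    exact ⟨hf, fun g hg => h ▸ epsMin_le hg i⟩

theorem epsMinLocus_eq {Λ : Set (RepVariety k K ν)} (i : GridVertex m) :
    epsMinLocus Λ i = Λ ∩ {f | epsPoint f.1 i ≤ epsMin Λ i} := by
  ext f
  constructor
  · intro hf
    exact ⟨hf.1, ((mem_epsMinLocus_iff hf.1 i).1 hf).le⟩
  · rintro ⟨hf, he⟩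
    exact (mem_epsMinLocus_iff hf i).2 (le_antisymm he (epsMin_le hf i))

theorem exists_extMinLocus_eq {Λ : Set (RepVariety k K ν)} (h : Λ.Nonempty) (i : GridVertex m) :
    ∃ c, extMinLocus Λ i = Λ ∩ {f | extDim f.1 i ≤ c} ∧ (∀ f ∈ extMinLocus Λ i, extDim f.1 i = c) ∧
      (extMinLocus Λ i).Nonempty := by
  obtain ⟨f, hf, hmin⟩ := exists_min_of_nonempty h fun f => extDim f.1 i
  refine ⟨extDim f.1 i, ?_, fun g hg => le_antisymm (hg.2 f hf) (hmin g hg.1), f, hf, hmin⟩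
  ext g
  exact ⟨fun hg => ⟨hg.1, hg.2 f hf⟩, fun hg => ⟨hg.1, fun g' hg' => hg.2.trans (hmin g' hg')⟩⟩

theorem isPreirreducible_inter_of_isOpen {X : Type*} [TopologicalSpace X] {S U : Set X}
    (hS : IsPreirreducible S) (hU : IsOpen U) : IsPreirreducible (S ∩ U) := by
  rintro V W hV hW ⟨x, ⟨hxS, hxU⟩, hxV⟩ ⟨y, ⟨hyS, hyU⟩, hyW⟩
  obtain ⟨z, hzS, ⟨hzU, hzV⟩, -, hzW⟩ := hS (U ∩ V) (U ∩ W) (hU.inter hV) (hU.inter hW)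
    ⟨x, hxS, hxU, hxV⟩ ⟨y, hyS, hyU, hyW⟩
  exact ⟨z, ⟨hzS, hzU⟩, hzV, hzW⟩

theorem le_epsPoint_of_mem_closure [Infinite K] {Λ : Set (RepVariety k K ν)} {i : GridVertex m}
    {c : ℕ} (h : ∀ f ∈ Λ, c ≤ epsPoint f.1 i) {f : RepVariety k K ν} (hf : f ∈ closure Λ) :
    c ≤ epsPoint f.1 i := by
  by_contra! hlt
  obtain ⟨g, hg, hgΛ⟩ := mem_closure_iff.1 hf _ (isOpen_epsPoint_le i (epsPoint f.1 i))
    (le_refl (epsPoint f.1 i))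
  exact absurd (h g hgΛ) (not_le.2 (lt_of_le_of_lt hg hlt))

/-- By semicontinuity `ε_i` cannot drop below its lower bound on passing to the closure. -/
theorem epsMin_closure [Infinite K] {Λ : Set (RepVariety k K ν)} {i : GridVertex m}
    {c : ℕ} (h : ∀ f ∈ Λ, c ≤ epsPoint f.1 i) {f : RepVariety k K ν} (hf : f ∈ Λ)
    (hfc : epsPoint f.1 i = c) : epsMin (closure Λ) i = c := by
  refine le_antisymm (hfc ▸ epsMin_le (subset_closure hf) i) ?_
  obtain ⟨g, hg, he⟩ := exists_epsPoint_eq_epsMin ⟨f, subset_closure hf⟩ i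
  exact he ▸ le_epsPoint_of_mem_closure h hg

/-! ### Going up and down between irreducible components. -/

variable {ν₁ : GridVertex m → ℕ} {i : GridVertex m}

/-- The set whose closure is `f̃_i`. -/
def fImage (ν : GridVertex m → ℕ) (Λ : Set (RepVariety k K ν₁)) (i : GridVertex m) :
    Set (RepVariety k K ν) :=
  ExtVariety.toMid '' ((ExtVariety.toSub : ExtVariety k K ν₁ ν (Pi.single i 1) → _) ⁻¹'
    extMinLocus Λ i)

/-- The set whose closure is `ẽ_i`. -/
def eImage (ν₁ : GridVertex m → ℕ) (Λ : Set (RepVariety k K ν)) (i : GridVertex m) :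
    Set (RepVariety k K ν₁) :=
  ExtVariety.toSub '' ((ExtVariety.toMid : ExtVariety k K ν₁ ν (Pi.single i 1) → _) ⁻¹'
    epsMinLocus Λ i)

theorem epsMin_closure_fImage
    (hν : ∀ j, ν j = ν₁ j + (Pi.single i 1 : GridVertex m → ℕ) j)
    [Infinite K] {Λ : Set (RepVariety k K ν₁)} (hΛ : IsIrreducible Λ) :
    epsMin (closure (fImage ν Λ i)) i = epsMin Λ i + 1 := by
  obtain ⟨c, hc, -, f₀, hf₀⟩ := exists_extMinLocus_eq hΛ.nonempty i
  obtain ⟨f₁, hf₁, he₁⟩ := exists_epsPoint_eq_epsMin hΛ.nonempty i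
  -- Two nonempty open parts of an irreducible set meet: some point minimizes `extDim` and `ε_i` at
  -- once.
  obtain ⟨f, hf, hfc, hfe⟩ := hΛ.2 _ _ (isOpen_extDim_le i c) (isOpen_epsPoint_le i (epsMin Λ i))
    ⟨f₀, by rwa [hc] at hf₀⟩ ⟨f₁, hf₁, he₁.le⟩
  obtain ⟨x, rfl⟩ := exists_toSub_eq hν f
  refine epsMin_closure ?_ (f := x.toMid) ⟨x, ?_, rfl⟩ ?_
  · rintro _ ⟨y, hy, rfl⟩
    rw [epsPoint_toMid hν]
    exact Nat.add_le_add_right (epsMin_le hy.1 i) 1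
  · rw [Set.mem_preimage, hc]
    exact ⟨hf, hfc⟩
  · rw [epsPoint_toMid hν, le_antisymm hfe (epsMin_le hf i)]

theorem isIrreducible_fImage
    (hν : ∀ j, ν j = ν₁ j + (Pi.single i 1 : GridVertex m → ℕ) j)
    [Infinite K] {Λ : Set (RepVariety k K ν₁)} (hΛ : IsIrreducible Λ) :
    IsIrreducible (fImage ν Λ i) := by
  obtain ⟨c, hc, hconst, f₀, hf₀⟩ := exists_extMinLocus_eq hΛ.nonempty i
  obtain ⟨x, rfl⟩ := exists_toSub_eq hν f₀
  refine ⟨⟨x.toMid, x, hf₀, rfl⟩, ?_⟩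
  refine (isPreirreducible_toSub_preimage hν ?_ hconst).image _
    ExtVariety.continuous_toMid.continuousOn
  rw [hc]
  exact isPreirreducible_inter_of_isOpen hΛ.2 (isOpen_extDim_le i c)

theorem isPreirreducible_toMid_preimage_epsMinLocus
    (hν : ∀ j, ν j = ν₁ j + (Pi.single i 1 : GridVertex m → ℕ) j)
    [Infinite K] {Λ : Set (RepVariety k K ν)}
    (hΛ : IsIrreducible Λ) : IsPreirreducible
      ((ExtVariety.toMid : ExtVariety k K ν₁ ν (Pi.single i 1) → _) ⁻¹' epsMinLocus Λ i) := by
  refine isPreirreducible_toMid_preimage hν ?_ fun f hf => (mem_epsMinLocus_iff hf.1 i).1 hf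
  rw [epsMinLocus_eq]
  exact isPreirreducible_inter_of_isOpen hΛ.2 (isOpen_epsPoint_le i _)

theorem isIrreducible_eImage
    (hν : ∀ j, ν j = ν₁ j + (Pi.single i 1 : GridVertex m → ℕ) j)
    [Infinite K] {Λ : Set (RepVariety k K ν)} (hΛ : IsIrreducible Λ)
    (hpos : 0 < epsMin Λ i) : IsIrreducible (eImage ν₁ Λ i) := by
  obtain ⟨h, hh, he⟩ := exists_epsPoint_eq_epsMin hΛ.nonempty i
  obtain ⟨x, rfl⟩ := exists_toMid_eq hν (he ▸ hpos)
  exact ⟨⟨x.toSub, x, (mem_epsMinLocus_iff hh i).2 he, rfl⟩,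
    (isPreirreducible_toMid_preimage_epsMinLocus hν hΛ).image _
      ExtVariety.continuous_toSub.continuousOn⟩

theorem closure_eImage_closure_fImage
    (hν : ∀ j, ν j = ν₁ j + (Pi.single i 1 : GridVertex m → ℕ) j)
    [Infinite K] {Λ : Set (RepVariety k K ν₁)}
    (hΛ : Λ ∈ irreducibleComponents (RepVariety k K ν₁)) :
    closure (eImage ν₁ (closure (fImage ν Λ i)) i) = Λ := by
  have hirr : IsIrreducible Λ := hΛ.1
  have heps := epsMin_closure_fImage hν hirr
  have hF : IsIrreducible (closure (fImage ν Λ i)) := (isIrreducible_fImage hν hirr).closure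
  have hE := (isIrreducible_eImage hν hF (by omega)).closure
  refine (hΛ.eq_of_subset hE ?_).symm
  obtain ⟨c, hc, -, f₀, hf₀⟩ := exists_extMinLocus_eq hirr.nonempty i
  obtain ⟨f₁, hf₁, he₁⟩ := exists_epsPoint_eq_epsMin hirr.nonempty i
  obtain ⟨f, hf, hfc, hfe⟩ := hirr.2 _ _ (isOpen_extDim_le i c)
    (isOpen_epsPoint_le i (epsMin Λ i)) ⟨f₀, by rwa [hc] at hf₀⟩ ⟨f₁, hf₁, he₁.le⟩
  -- By maximality of `Λ` one inclusion suffices, and it may be checked on the dense open part where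
  -- both invariants are minimal.
  refine (subset_closure_inter_of_isPreirreducible_of_isOpen hirr.2
    ((isOpen_extDim_le i c).inter (isOpen_epsPoint_le i (epsMin Λ i)))
      ⟨f, hf, hfc, hfe⟩).trans (closure_mono ?_)
  rintro g ⟨hg, hgc, hge⟩
  obtain ⟨x, rfl⟩ := exists_toSub_eq hν g
  have hx : x.toMid ∈ fImage ν Λ i := ⟨x, by rw [Set.mem_preimage, hc]; exact ⟨hg, hgc⟩, rfl⟩
  refine ⟨x, (mem_epsMinLocus_iff (subset_closure hx) i).2 ?_, rfl⟩
  rw [heps, epsPoint_toMid hν, le_antisymm hge (epsMin_le hg i)]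

theorem closure_fImage_closure_eImage
    (hν : ∀ j, ν j = ν₁ j + (Pi.single i 1 : GridVertex m → ℕ) j)
    [Infinite K] {Λ : Set (RepVariety k K ν)}
    (hΛ : Λ ∈ irreducibleComponents (RepVariety k K ν)) (hpos : 0 < epsMin Λ i) :
    closure (fImage ν (closure (eImage ν₁ Λ i)) i) = Λ := by
  have hirr : IsIrreducible Λ := hΛ.1
  have hE : IsIrreducible (closure (eImage ν₁ Λ i)) :=
    (isIrreducible_eImage hν hirr hpos).closure
  refine (hΛ.eq_of_subset (isIrreducible_fImage hν hE).closure ?_).symm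
  obtain ⟨c, hc, -, f₀, hf₀⟩ := exists_extMinLocus_eq hE.nonempty i
  rw [hc] at hf₀
  -- The minimum of `extDim` on the closure is already attained on the image itself, hence by the
  -- subrepresentation of an actual extension `x₀`.
  obtain ⟨_, hfc, x₀, hx₀, rfl⟩ := mem_closure_iff.1 hf₀.1 _ (isOpen_extDim_le i c) hf₀.2
  intro h hh
  rw [mem_closure_iff]
  intro U hU hhU
  obtain ⟨h₁, hh₁, he₁⟩ := exists_epsPoint_eq_epsMin hirr.nonempty i
  obtain ⟨h₂, hh₂, hU₂, he₂⟩ := hirr.2 U _ hU (isOpen_epsPoint_le i (epsMin Λ i)) ⟨h, hh, hhU⟩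
    ⟨h₁, hh₁, he₁.le⟩
  have he₂' := le_antisymm he₂ (epsMin_le hh₂ i)
  obtain ⟨x₂, rfl⟩ := exists_toMid_eq hν (he₂' ▸ hpos)
  -- Irreducibility of the space of extensions combines two open conditions: `x₂` has middle term in
  -- `U`, `x₀` has a subrepresentation minimizing `extDim`, and `x` has both.
  obtain ⟨x, hx, hxU, hxc⟩ := isPreirreducible_toMid_preimage_epsMinLocus hν hirr _ _
    (hU.preimage ExtVariety.continuous_toMid)
    ((isOpen_extDim_le i c).preimage ExtVariety.continuous_toSub)
    ⟨x₂, (mem_epsMinLocus_iff hh₂ i).2 he₂', hU₂⟩ ⟨x₀, hx₀, hfc⟩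
  refine ⟨x.toMid, hxU, x, ?_, rfl⟩
  rw [Set.mem_preimage, hc]
  exact ⟨subset_closure ⟨x, hx, rfl⟩, hxc⟩

end Operators

/-! ### The crystal axioms. -/

section Crystal

variable {k K : Type*} [Field k] [Field K] [Algebra k K] {d : ℕ} {m : Fin d → ℕ}

/-- Because `fImage` takes the dimension vector of the middle term as a free parameter, nothing has
to be transported along an equality of dimension vectors. -/
theorem fOp_eq_some_iff {i : GridVertex m} {b b₁ : IrrComp k K m} : fOp i b = some b₁ ↔
    b₁.1 = b.1 + Pi.single i 1 ∧ b₁.2.1 = closure (fImage b₁.1 b.2.1 i) := by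
  obtain ⟨ν, Λ, hΛ⟩ := b
  obtain ⟨ν', Λ', hΛ'⟩ := b₁
  constructor
  · intro h
    unfold fOp at h
    split_ifs at h with hc
    cases h
    exact ⟨rfl, rfl⟩
  · rintro ⟨h1, h2⟩
    change ν' = ν + Pi.single i 1 at h1
    subst h1
    change Λ' = fClosure Λ i at h2
    subst h2
    exact dif_pos hΛ'

theorem epsPoint_le {ν : GridVertex m → ℕ} (f : RepSpace K ν) (i : GridVertex m) :
    epsPoint f i ≤ ν i := by
  have h := (LinearMap.range (inMap f i)).finrank_quotient_add_finrank
  rw [Module.finrank_fintype_fun_eq_card, Fintype.card_fin] at h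
  rw [epsPoint]
  omega

theorem eOp_eq_some_iff {i : GridVertex m} {b b₁ : IrrComp k K m} : eOp i b₁ = some b ↔
    0 < epsMin b₁.2.1 i ∧ b₁.1 = b.1 + Pi.single i 1 ∧
      b.2.1 = closure (eImage b.1 b₁.2.1 i) := by
  obtain ⟨ν, Λ, hΛ⟩ := b₁
  obtain ⟨ν', Λ', hΛ'⟩ := b
  constructor
  · intro h
    unfold eOp at h
    split_ifs at h with hc
    cases h
    refine ⟨hc.1, ?_, rfl⟩
    obtain ⟨f, hf, he⟩ := exists_epsPoint_eq_epsMin hΛ.1.nonempty i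
    -- This makes the truncated subtraction of `Pi.single i 1` reversible.
    have h1 : 0 < ν i := lt_of_lt_of_le hc.1 (he ▸ epsPoint_le f.1 i)
    funext j
    change ν j = ν j - (Pi.single i 1 : GridVertex m → ℕ) j + (Pi.single i 1 : GridVertex m → ℕ) j
    by_cases hj : j = i
    · subst hj
      rw [Pi.single_eq_same]
      omega
    · rw [single_eq_zero hj]
      omega
  · rintro ⟨h0, h1, h2⟩
    change ν = ν' + Pi.single i 1 at h1
    have h3 : ν' = ν - Pi.single i 1 := by
      rw [h1, add_tsub_cancel_right]
    clear h1
    subst h3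
    change Λ' = eClosure Λ i at h2
    subst h2
    exact dif_pos ⟨h0, hΛ'⟩

theorem eOp_eq_some_iff_fOp [Infinite K] {i : GridVertex m} {b b₁ : IrrComp k K m} :
    eOp i b₁ = some b ↔ fOp i b = some b₁ := by
  rw [eOp_eq_some_iff, fOp_eq_some_iff]
  constructor
  · rintro ⟨h0, h1, h2⟩
    refine ⟨h1, ?_⟩
    rw [h2, closure_fImage_closure_eImage (congrFun h1) b₁.2.2 h0]
  · rintro ⟨h1, h2⟩
    refine ⟨?_, h1, ?_⟩
    · rw [h2, epsMin_closure_fImage (congrFun h1) b.2.2.1]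
      exact Nat.succ_pos _
    · rw [h2, closure_eImage_closure_fImage (congrFun h1) b.2.2]

theorem eps_of_fOp [Infinite K] {i : GridVertex m} {b b₁ : IrrComp k K m}
    (h : fOp i b = some b₁) : epsMin b₁.2.1 i = epsMin b.2.1 i + 1 := by
  obtain ⟨h1, h2⟩ := fOp_eq_some_iff.1 h
  rw [h2, epsMin_closure_fImage (congrFun h1) b.2.2.1]

variable {𝔥 : Type*} [AddCommGroup 𝔥] [Module ℂ 𝔥]
  {R : Realization (quiverCartanMatrix (GridVertex m)) 𝔥} (P : WeightLattice R)

theorem wt_of_fOp {i : GridVertex m} {b b₁ : IrrComp k K m}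
    (h : fOp i b = some b₁) : wt P b₁ = wt P b - P.simpleRoot i := by
  obtain ⟨h1, -⟩ := fOp_eq_some_iff.1 h
  rw [wt, wt, h1]
  simp only [Pi.add_apply, add_smul, Finset.sum_add_distrib]
  rw [Finset.sum_eq_single (f := fun j => (Pi.single i 1 : GridVertex m → ℕ) j • P.simpleRoot j) i]
  · rw [Pi.single_eq_same, one_smul, neg_add, sub_eq_add_neg]
  · intro j _ hj
    rw [single_eq_zero hj, zero_smul]
  · simp

theorem pairing_sub_simpleRoot (i : GridVertex m) (μ : P.carrier) :
    P.pairing i (μ - P.simpleRoot i) = P.pairing i μ - 2 := by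
  have h1 := P.pairing_spec i (μ - P.simpleRoot i)
  have h2 := P.pairing_spec i μ
  have h3 : (P.simpleRoot i).1 (R.coroot i) = 2 := by
    change R.root i (R.coroot i) = 2
    rw [R.pairing_eq, quiverCartanMatrix, if_pos rfl]
    norm_num
  rw [AddSubgroup.coe_sub, LinearMap.sub_apply, h2, h3] at h1
  exact_mod_cast h1.symm

theorem phi_of_fOp [Infinite K] {i : GridVertex m} {b b₁ : IrrComp k K m}
    (h : fOp i b = some b₁) : phi P i b₁ = phi P i b + ((-1 : ℤ) : WithBot ℤ) := by
  -- `ε_i` rises by `1` while the pairing with `h_i` drops by `2`.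
  rw [phi, phi, eps, eps, eps_of_fOp h, wt_of_fOp P h, pairing_sub_simpleRoot]
  rw [← WithBot.coe_add, ← WithBot.coe_add, ← WithBot.coe_add]
  congr 1
  push_cast
  ring

theorem isGeneralizedCartanMatrix_quiverCartanMatrix (V : Type*) [Quiver V] [DecidableEq V] :
    IsGeneralizedCartanMatrix (quiverCartanMatrix V) where
  diag i := if_pos rfl
  nonpos i j h := by
    rw [quiverCartanMatrix, if_neg h]
    omega
  zero_symm i j h := by
    rw [quiverCartanMatrix, quiverCartanMatrix, if_neg h, if_neg h.symm]
    omega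

end Crystal

end GridCrystal

end

theorem theorem3p9 {k K : Type*} [Field k] [Field K] [Algebra k K] [Infinite K]
    {d : ℕ} (m : Fin d → ℕ) {𝔥 : Type*} [AddCommGroup 𝔥] [Module ℂ 𝔥]
    (R : GridCrystal.Realization (GridCrystal.quiverCartanMatrix (GridCrystal.GridVertex m)) 𝔥)
    (P : GridCrystal.WeightLattice R) :
    GridCrystal.IsCrystal P
      (GridCrystal.wt P : GridCrystal.IrrComp k K m → P.carrier)
      GridCrystal.eps (GridCrystal.phi P) GridCrystal.eOp GridCrystal.fOp := by
  have heps : ∀ (i : GridCrystal.GridVertex m) (b b₁ : GridCrystal.IrrComp k K m),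
      GridCrystal.fOp i b = some b₁ →
        GridCrystal.eps i b₁ = GridCrystal.eps i b + ((1 : ℤ) : WithBot ℤ) := by
    intro i b b₁ h
    rw [GridCrystal.eps, GridCrystal.eps, GridCrystal.eps_of_fOp h, ← WithBot.coe_add]
    push_cast
    rfl
  exact
    { cartan := GridCrystal.isGeneralizedCartanMatrix_quiverCartanMatrix _
      phi_eq := fun i b => rfl
      wt_e := fun i b b₁ h => by
        rw [GridCrystal.wt_of_fOp P (GridCrystal.eOp_eq_some_iff_fOp.1 h), sub_add_cancel]
      eps_e := fun i b b₁ h => by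
        rw [heps i b₁ b (GridCrystal.eOp_eq_some_iff_fOp.1 h), add_assoc, ← WithBot.coe_add]
        simp
      phi_e := fun i b b₁ h => by
        rw [GridCrystal.phi_of_fOp P (GridCrystal.eOp_eq_some_iff_fOp.1 h), add_assoc,
          ← WithBot.coe_add]
        simp
      wt_f := fun i b b₁ h => GridCrystal.wt_of_fOp P h
      eps_f := heps
      phi_f := fun i b b₁ h => GridCrystal.phi_of_fOp P h
      e_eq_iff := fun i b b₁ => GridCrystal.eOp_eq_some_iff_fOp
      of_phi_eq_bot := fun i b h => by
        -- `φ_i` takes only integer values, so the axiom is vacuous.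
        rw [GridCrystal.phi, GridCrystal.eps, ← WithBot.coe_add] at h
        exact (WithBot.coe_ne_bot h).elim }
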